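/- **Conventions.** A *De Morgan algebra* is a bounded distributive lattice with an involution $\neg$ such that $\neg(a\vee b)=\neg a\wedge\neg b$. Let $\square$ be the Lawvere theory of De Morgan algebras: its objects are the natural numbers, a morphism $m\to n$ is an $n$-tuple of elements of the free De Morgan algebra $\mathbb I(m)$ on $m$ generators, and composition is substitution. Let $\mathbb F(n)$ be the bounded distributive lattice generated by symbols $(i=0),(i=1)$ for $1\le i\le n$ subject to $(i=0)\wedge(i=1)=\bot$; the assignment $i\mapsto(i=0)$ extends to a map $\mathbb I(n)\to\mathbb F(n)$, $r\mapsto (r=0)$, determined together with $r\mapsto(r=1)$ by $(r\vee s=0)=(r=0)\wedge(s=0)$, $(r\vee s=1)=(r=1)\vee(s=1)$, dually for $\wedge$, and $(\neg r=0)=(r=1)$. With substitution as restriction, $\mathbb I$ and $\mathbb F$ are presheaves on $\square$. For a small category $\mathcal C$ write $\mathbb I_{\mathcal C}(c,n)=\mathbb I(n)$ and $\mathbb F_{\mathcal C}(c,n)=\mathbb F(n)$ for the resulting De Morgan algebra, respectively bounded distributive lattice, in $\mathrm{PSh}(\mathcal C\times\square)$. A *universe* in an elementary topos is a map $\pi:\mathrm{El}\to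 U$ such that the class of *small* maps (the pullbacks of $\pi$) contains all monomorphisms, is closed under composition and dependent products, and contains $\Omega\to1$ and $N\to 1$ for a natural numbers object $N$. A *hierarchy of universes* indexed by a linear order $J$ is a family of universes $(\pi_j:\mathrm{El}_j\to U_j)_{j\in J}$ such that for $i<j$ the map $U_i\to1$ is $j$-small and every $i$-small map is $j$-small. A *LOPS topos* (with a hierarchy indexed by $J$) is an elementary topos $\mathcal E$ with a De Morgan algebra $\mathbb I_{\mathcal E}$ (with endpoints $0=\bot$, $1=\top$), an object of cofibrations $\Phi_{\mathcal E}\hookrightarrow\Omega$ and a hierarchy of universes, such that $\mathbb I_{\mathcal E}$ is tiny, i.e. $(-)^{\mathbb I_{\mathcal E}}$ has a right adjoint, $\mathbb I_{\mathcal E}\to 1$ is small for each universe, and the Orton–Pitts axioms hold in the internal language, where $\mathrm{cof}(\varphi)$ means $\varphi\in\Phi_{\mathcal E}$: * $(\forall i:\mathbb I_{\mathcal E}.\ \varphi(i)\vee\neg\varphi(i))\Rightarrow(\forall i.\ \varphi(i))\vee(\forall i.\ \neg\varphi(i))$ for all $\varphi:\mathbb I_{\mathcal E}\to\Omega$; *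 $\neg(0=1)$; * $\mathrm{cof}(i=0)$ and $\mathrm{cof}(i=1)$ for all $i:\mathbb I_{\mathcal E}$; * $\mathrm{cof}(\varphi)\wedge\mathrm{cof}(\psi)\Rightarrow\mathrm{cof}(\varphi\vee\psi)$; * $\mathrm{cof}(\varphi)\wedge(\varphi\Rightarrow\mathrm{cof}(\psi))\Rightarrow\mathrm{cof}(\varphi\wedge\psi)$; * $(\forall i:\mathbb I_{\mathcal E}.\ \mathrm{cof}(\varphi(i)))\Rightarrow\mathrm{cof}(\forall i.\ \varphi(i))$; * strictness, for each universe $U$: if a family named by $B:X\to U$ is isomorphic, over a subobject $S\hookrightarrow X$ classified by a map to $\Phi_{\mathcal E}$, to the family named by some $A:S\to U$, then there is $B':X\to U$ with $B'|_S=A$ such that the family named by $B'$ is isomorphic to the one named by $B$, by an isomorphism extending the given one. (The axioms for connections on $\mathbb I_{\mathcal E}$ are part of its being a De Morgan algebra.) These axioms make $\Phi_{\mathcal E}$ a bounded sublattice of $\Omega$ and give a map $(-=0):\mathbb I_{\mathcal E}\to\Phi_{\mathcal E}$. A *morphism of LOPS topoi* is an adjunction $L\dashv R$, $R:\mathcal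 E\to\mathcal E'$, with $L$ preserving finite limits, together with an isomorphism of De Morgan algebras $\alpha:L(\mathbb I_{\mathcal E'})\cong\mathbb I_{\mathcal E}$ and an isomorphism of bounded distributive lattices $\beta:L(\Phi_{\mathcal E'})\cong\Phi_{\mathcal E}$ such that $\beta\circ L(-=0)=(-=0)\circ\alpha$. **Proposition.** Let $\mathcal C,\mathcal D$ be small categories, let $F:\mathcal C\to\mathcal D$ be a functor, and write $F^*$, $F_!$, $F_*$ for precomposition with, respectively left and right Kan extension along, $F\times\mathrm{id}_\square$, as functors between $\mathrm{PSh}(\mathcal C\times\square)$ and $\mathrm{PSh}(\mathcal D\times\square)$. Let $(\kappa_j)_{j\in J}$ be a strictly increasing family of inaccessible cardinals (for instance with $J=\mathbb N$), all larger than the cardinalities of the sets of morphisms of $\mathcal C$ and of $\mathcal D$. 1. $\mathrm{PSh}(\mathcal C\times\square)$ and $\mathrm{PSh}(\mathcal D\times\square)$, with intervals $\mathbb I_{\mathcal C}$, $\mathbb I_{\mathcal D}$ and objects of cofibrations $\mathbb F_{\mathcal C}$, $\mathbb F_{\mathcal D}$, are LOPS topoi with hierarchies of universes indexed by $J$. 2.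 The adjunction $F^*\dashv F_*$ underlies a morphism of LOPS topoi. 3. If $F_!$ preserves finite limits, then the adjunction $F_!\dashv F^*$ underlies a morphism of LOPS topoi. -/

import Mathlib

open CategoryTheory Limits MonoidalCategory CartesianMonoidalCategory

universe w

namespace LOPS

/-! ### De Morgan algebras and the free ones -/

/-- A De Morgan algebra: a bounded distributive lattice with an involution `neg`
satisfying De Morgan's laws (the law for `⊓` follows from the one for `⊔`). -/
class DeMorganAlgebra (A : Type*) extends DistribLattice A, BoundedOrder A where
  neg : A → A
  neg_neg : ∀ a : A, neg (neg a) = a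
  neg_sup : ∀ a b : A, neg (a ⊔ b) = neg a ⊓ neg b

theorem DeMorganAlgebra.neg_inf {A : Type*} [DeMorganAlgebra A] (a b : A) :
    neg (a ⊓ b) = neg a ⊔ neg b := by
  have h := neg_sup (neg a) (neg b)
  rw [neg_neg, neg_neg] at h
  rw [← h, neg_neg]

theorem DeMorganAlgebra.neg_bot {A : Type*} [DeMorganAlgebra A] : neg (⊥ : A) = ⊤ := by
  have h := neg_sup (⊥ : A) (neg ⊤)
  rw [bot_sup_eq, neg_neg, inf_top_eq] at h
  exact h.symm

theorem DeMorganAlgebra.neg_top {A : Type*} [DeMorganAlgebra A] : neg (⊤ : A) = ⊥ := by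
  rw [← neg_bot, neg_neg]

/-- Terms of the language of De Morgan algebras in `n` variables. -/
inductive DMTerm (n : ℕ) : Type
  | var : Fin n → DMTerm n
  | bot : DMTerm n
  | top : DMTerm n
  | inf : DMTerm n → DMTerm n → DMTerm n
  | sup : DMTerm n → DMTerm n → DMTerm n
  | neg : DMTerm n → DMTerm n

/-- Provable equality of terms from the equations of De Morgan algebras. -/
inductive DMTerm.Rel {n : ℕ} : DMTerm n → DMTerm n → Prop
  | refl (a) : Rel a a
  | symm {a b} : Rel a b → Rel b a
  | trans {a b c} : Rel a b → Rel b c → Rel a c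
  | congr_inf {a a' b b'} : Rel a a' → Rel b b' → Rel (inf a b) (inf a' b')
  | congr_sup {a a' b b'} : Rel a a' → Rel b b' → Rel (sup a b) (sup a' b')
  | congr_neg {a a'} : Rel a a' → Rel (neg a) (neg a')
  | inf_comm (a b) : Rel (inf a b) (inf b a)
  | sup_comm (a b) : Rel (sup a b) (sup b a)
  | inf_assoc (a b c) : Rel (inf (inf a b) c) (inf a (inf b c))
  | sup_assoc (a b c) : Rel (sup (sup a b) c) (sup a (sup b c))
  | sup_inf_self (a b) : Rel (sup a (inf a b)) a
  | inf_sup_self (a b) : Rel (inf a (sup a b)) a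
  | inf_sup_left (a b c) : Rel (inf a (sup b c)) (sup (inf a b) (inf a c))
  | sup_bot (a) : Rel (sup a bot) a
  | inf_top (a) : Rel (inf a top) a
  | neg_neg (a) : Rel (neg (neg a)) a
  | neg_sup (a b) : Rel (neg (sup a b)) (inf (neg a) (neg b))

instance DMTerm.setoid (n : ℕ) : Setoid (DMTerm n) where
  r := DMTerm.Rel
  iseqv := ⟨.refl, .symm, .trans⟩

/-- The free De Morgan algebra on `n` generators. -/
def FreeDM (n : ℕ) : Type := Quotient (DMTerm.setoid n)

namespace FreeDM

variable {n : ℕ}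

def mk (t : DMTerm n) : FreeDM n := Quotient.mk _ t

def var (i : Fin n) : FreeDM n := mk (.var i)

@[reducible] def minInst (n : ℕ) : Min (FreeDM n) :=
  ⟨Quotient.map₂ DMTerm.inf fun _ _ h _ _ h' => DMTerm.Rel.congr_inf h h'⟩

@[reducible] def maxInst (n : ℕ) : Max (FreeDM n) :=
  ⟨Quotient.map₂ DMTerm.sup fun _ _ h _ _ h' => DMTerm.Rel.congr_sup h h'⟩

@[reducible] def latticeInst (n : ℕ) : Lattice (FreeDM n) :=
  letI := minInst n
  letI := maxInst n
  Lattice.mk'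
    (by rintro ⟨a⟩ ⟨b⟩; exact Quotient.sound (DMTerm.Rel.sup_comm a b))
    (by rintro ⟨a⟩ ⟨b⟩ ⟨c⟩; exact Quotient.sound (DMTerm.Rel.sup_assoc a b c))
    (by rintro ⟨a⟩ ⟨b⟩; exact Quotient.sound (DMTerm.Rel.inf_comm a b))
    (by rintro ⟨a⟩ ⟨b⟩ ⟨c⟩; exact Quotient.sound (DMTerm.Rel.inf_assoc a b c))
    (by rintro ⟨a⟩ ⟨b⟩; exact Quotient.sound (DMTerm.Rel.sup_inf_self a b))
    (by rintro ⟨a⟩ ⟨b⟩; exact Quotient.sound (DMTerm.Rel.inf_sup_self a b))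

instance (n : ℕ) : DistribLattice (FreeDM n) :=
  letI := latticeInst n
  DistribLattice.ofInfSupLe (by
    rintro ⟨a⟩ ⟨b⟩ ⟨c⟩; exact le_of_eq (Quotient.sound (DMTerm.Rel.inf_sup_left a b c)))

instance : DeMorganAlgebra (FreeDM n) where
  top := mk .top
  bot := mk .bot
  le_top := by
    rintro ⟨a⟩; exact inf_eq_left.1 (Quotient.sound (DMTerm.Rel.inf_top a))
  bot_le := by
    rintro ⟨a⟩; exact sup_eq_left.1 (Quotient.sound (DMTerm.Rel.sup_bot a))
  neg := Quotient.map DMTerm.neg fun _ _ h => DMTerm.Rel.congr_neg h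
  neg_neg := by rintro ⟨a⟩; exact Quotient.sound (DMTerm.Rel.neg_neg a)
  neg_sup := by rintro ⟨a⟩ ⟨b⟩; exact Quotient.sound (DMTerm.Rel.neg_sup a b)

/-- Evaluation of a term in a De Morgan algebra. -/
def eval {A : Type*} [DeMorganAlgebra A] (f : Fin n → A) : DMTerm n → A
  | .var i => f i
  | .bot => ⊥
  | .top => ⊤
  | .inf a b => eval f a ⊓ eval f b
  | .sup a b => eval f a ⊔ eval f b
  | .neg a => DeMorganAlgebra.neg (eval f a)

theorem eval_rel {A : Type*} [DeMorganAlgebra A] (f : Fin n → A) {a b : DMTerm n}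
    (h : DMTerm.Rel a b) : eval f a = eval f b := by
  induction h with
  | refl => rfl
  | symm _ ih => exact ih.symm
  | trans _ _ ih ih' => exact ih.trans ih'
  | congr_inf _ _ ih ih' => simp only [eval, ih, ih']
  | congr_sup _ _ ih ih' => simp only [eval, ih, ih']
  | congr_neg _ ih => simp only [eval, ih]
  | inf_comm => exact _root_.inf_comm _ _
  | sup_comm => exact _root_.sup_comm _ _
  | inf_assoc => exact _root_.inf_assoc _ _ _
  | sup_assoc => exact _root_.sup_assoc _ _ _
  | sup_inf_self => exact _root_.sup_inf_self
  | inf_sup_self => exact _root_.inf_sup_self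
  | inf_sup_left => exact _root_.inf_sup_left _ _ _
  | sup_bot => exact sup_bot_eq _
  | inf_top => exact inf_top_eq _
  | neg_neg => exact DeMorganAlgebra.neg_neg _
  | neg_sup => exact DeMorganAlgebra.neg_sup _ _

/-- The homomorphism out of the free De Morgan algebra determined by the images of the
generators. -/
def lift {A : Type*} [DeMorganAlgebra A] (f : Fin n → A) : BoundedLatticeHom (FreeDM n) A where
  toFun := Quotient.lift (eval f) fun _ _ h => eval_rel f h
  map_inf' := by rintro ⟨a⟩ ⟨b⟩; rfl
  map_sup' := by rintro ⟨a⟩ ⟨b⟩; rfl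
  map_top' := rfl
  map_bot' := rfl

theorem lift_neg {A : Type*} [DeMorganAlgebra A] (f : Fin n → A) (r : FreeDM n) :
    lift f (DeMorganAlgebra.neg r) = DeMorganAlgebra.neg (lift f r) := by
  obtain ⟨r⟩ := r; rfl

theorem lift_var {A : Type*} [DeMorganAlgebra A] (f : Fin n → A) (i : Fin n) :
    lift f (var i) = f i := rfl

/-- Two homomorphisms that agree on generators are equal. -/
theorem hom_ext {A : Type*} [DeMorganAlgebra A] (g h : FreeDM n → A)
    (g_bot : g ⊥ = ⊥) (h_bot : h ⊥ = ⊥) (g_top : g ⊤ = ⊤) (h_top : h ⊤ = ⊤)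
    (g_inf : ∀ a b, g (a ⊓ b) = g a ⊓ g b) (h_inf : ∀ a b, h (a ⊓ b) = h a ⊓ h b)
    (g_sup : ∀ a b, g (a ⊔ b) = g a ⊔ g b) (h_sup : ∀ a b, h (a ⊔ b) = h a ⊔ h b)
    (g_neg : ∀ a, g (DeMorganAlgebra.neg a) = DeMorganAlgebra.neg (g a))
    (h_neg : ∀ a, h (DeMorganAlgebra.neg a) = DeMorganAlgebra.neg (h a))
    (e : ∀ i, g (var i) = h (var i)) (r : FreeDM n) : g r = h r := by
  obtain ⟨t⟩ := r
  change g (mk t) = h (mk t)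
  induction t with
  | var i => exact e i
  | bot => exact g_bot.trans h_bot.symm
  | top => exact g_top.trans h_top.symm
  | inf a b iha ihb =>
    change g (mk a ⊓ mk b) = h (mk a ⊓ mk b)
    rw [g_inf, h_inf, iha, ihb]
  | sup a b iha ihb =>
    change g (mk a ⊔ mk b) = h (mk a ⊔ mk b)
    rw [g_sup, h_sup, iha, ihb]
  | neg a iha =>
    change g (DeMorganAlgebra.neg (mk a)) = h (DeMorganAlgebra.neg (mk a))
    rw [g_neg, h_neg, iha]

theorem lift_var_self (r : FreeDM n) : lift var r = r :=
  hom_ext (lift var) id (map_bot _) rfl (map_top _) rfl (map_inf _) (fun _ _ => rfl)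
    (map_sup _) (fun _ _ => rfl) (lift_neg _) (fun _ => rfl) (fun _ => rfl) r

theorem lift_lift {m : ℕ} {A : Type*} [DeMorganAlgebra A] (f : Fin n → FreeDM m)
    (g : Fin m → A) (r : FreeDM n) : lift g (lift f r) = lift (fun i => lift g (f i)) r :=
  hom_ext (fun r => lift g (lift f r)) (lift fun i => lift g (f i))
    (by simp) (by simp) (by simp) (by simp) (by simp) (by simp) (by simp) (by simp)
    (fun a => by simp only [lift_neg]) (lift_neg _) (fun _ => rfl) r

end FreeDM

/-! ### The category of cubes -/

/-- Objects of the category of cubes: one for every (finite) number of dimensions. -/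
structure Cube : Type where
  dim : ℕ

/-- The Lawvere theory of De Morgan algebras: a morphism `X ⟶ Y` is a tuple of `Y.dim`
elements of the free De Morgan algebra on `X.dim` generators, and composition is
substitution. -/
instance : SmallCategory Cube where
  Hom X Y := Fin Y.dim → FreeDM X.dim
  id _ := FreeDM.var
  comp f g := fun i => FreeDM.lift f (g i)
  id_comp f := funext fun i => FreeDM.lift_var_self (f i)
  comp_id _ := rfl
  assoc f g h := funext fun i => (FreeDM.lift_lift g f (h i)).symm

/-! ### The face lattice -/

/-- Formal terms of the face lattice on `n` dimension variables. -/
inductive FaceTerm (n : ℕ) : Type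
  /-- the face `i = 0` -/
  | eqZero : Fin n → FaceTerm n
  /-- the face `i = 1` -/
  | eqOne : Fin n → FaceTerm n
  | bot : FaceTerm n
  | top : FaceTerm n
  | inf : FaceTerm n → FaceTerm n → FaceTerm n
  | sup : FaceTerm n → FaceTerm n → FaceTerm n

/-- Provable equality from the equations of bounded distributive lattices and
`(i = 0) ∧ (i = 1) = ⊥`. -/
inductive FaceTerm.Rel {n : ℕ} : FaceTerm n → FaceTerm n → Prop
  | refl (a) : Rel a a
  | symm {a b} : Rel a b → Rel b a
  | trans {a b c} : Rel a b → Rel b c → Rel a c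
  | congr_inf {a a' b b'} : Rel a a' → Rel b b' → Rel (inf a b) (inf a' b')
  | congr_sup {a a' b b'} : Rel a a' → Rel b b' → Rel (sup a b) (sup a' b')
  | inf_comm (a b) : Rel (inf a b) (inf b a)
  | sup_comm (a b) : Rel (sup a b) (sup b a)
  | inf_assoc (a b c) : Rel (inf (inf a b) c) (inf a (inf b c))
  | sup_assoc (a b c) : Rel (sup (sup a b) c) (sup a (sup b c))
  | sup_inf_self (a b) : Rel (sup a (inf a b)) a
  | inf_sup_self (a b) : Rel (inf a (sup a b)) a
  | inf_sup_left (a b c) : Rel (inf a (sup b c)) (sup (inf a b) (inf a c))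
  | sup_bot (a) : Rel (sup a bot) a
  | inf_top (a) : Rel (inf a top) a
  | disjoint (i) : Rel (inf (eqZero i) (eqOne i)) bot

instance FaceTerm.setoid (n : ℕ) : Setoid (FaceTerm n) where
  r := FaceTerm.Rel
  iseqv := ⟨.refl, .symm, .trans⟩

/-- The face lattice on `n` dimension variables: the bounded distributive lattice generated
by `(i = 0)`, `(i = 1)` subject to `(i = 0) ∧ (i = 1) = ⊥`. -/
def Face (n : ℕ) : Type := Quotient (FaceTerm.setoid n)

namespace Face

variable {n : ℕ}

def mk (t : FaceTerm n) : Face n := Quotient.mk _ t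

@[reducible] def minInst (n : ℕ) : Min (Face n) :=
  ⟨Quotient.map₂ FaceTerm.inf fun _ _ h _ _ h' => FaceTerm.Rel.congr_inf h h'⟩

@[reducible] def maxInst (n : ℕ) : Max (Face n) :=
  ⟨Quotient.map₂ FaceTerm.sup fun _ _ h _ _ h' => FaceTerm.Rel.congr_sup h h'⟩

@[reducible] def latticeInst (n : ℕ) : Lattice (Face n) :=
  letI := minInst n
  letI := maxInst n
  Lattice.mk'
    (by rintro ⟨a⟩ ⟨b⟩; exact Quotient.sound (FaceTerm.Rel.sup_comm a b))
    (by rintro ⟨a⟩ ⟨b⟩ ⟨c⟩; exact Quotient.sound (FaceTerm.Rel.sup_assoc a b c))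
    (by rintro ⟨a⟩ ⟨b⟩; exact Quotient.sound (FaceTerm.Rel.inf_comm a b))
    (by rintro ⟨a⟩ ⟨b⟩ ⟨c⟩; exact Quotient.sound (FaceTerm.Rel.inf_assoc a b c))
    (by rintro ⟨a⟩ ⟨b⟩; exact Quotient.sound (FaceTerm.Rel.sup_inf_self a b))
    (by rintro ⟨a⟩ ⟨b⟩; exact Quotient.sound (FaceTerm.Rel.inf_sup_self a b))

instance : DistribLattice (Face n) :=
  letI := latticeInst n
  DistribLattice.ofInfSupLe (by
    rintro ⟨a⟩ ⟨b⟩ ⟨c⟩; exact le_of_eq (Quotient.sound (FaceTerm.Rel.inf_sup_left a b c)))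

instance : BoundedOrder (Face n) where
  top := mk .top
  bot := mk .bot
  le_top := by
    rintro ⟨a⟩; exact inf_eq_left.1 (Quotient.sound (FaceTerm.Rel.inf_top a))
  bot_le := by
    rintro ⟨a⟩; exact sup_eq_left.1 (Quotient.sound (FaceTerm.Rel.sup_bot a))

theorem disjoint (i : Fin n) : mk (.eqZero i) ⊓ mk (.eqOne i) = ⊥ :=
  Quotient.sound (FaceTerm.Rel.disjoint i)

end Face

/-- Pairs of disjoint elements of a bounded distributive lattice, thought of as the truth
values of `r = 0` and `r = 1`. -/
@[ext]
structure FacePair (L : Type*) [DistribLattice L] [BoundedOrder L] where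
  zero : L
  one : L
  disj : zero ⊓ one = ⊥

namespace FacePair

variable {L : Type*} [DistribLattice L] [BoundedOrder L]

@[reducible] def maxInst (L : Type*) [DistribLattice L] [BoundedOrder L] : Max (FacePair L) :=
  ⟨fun p q => ⟨p.zero ⊓ q.zero, p.one ⊔ q.one, by
    have hp := p.disj
    have hq := q.disj
    rw [inf_sup_left, inf_right_comm, hp, bot_inf_eq, inf_assoc, hq, inf_bot_eq, bot_sup_eq]⟩⟩

@[reducible] def minInst (L : Type*) [DistribLattice L] [BoundedOrder L] : Min (FacePair L) :=
  ⟨fun p q => ⟨p.zero ⊔ q.zero, p.one ⊓ q.one, by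
    have hp := p.disj
    have hq := q.disj
    rw [inf_sup_right, ← inf_assoc, hp, bot_inf_eq, inf_left_comm, hq, inf_bot_eq,
      bot_sup_eq]⟩⟩

@[reducible] def latticeInst (L : Type*) [DistribLattice L] [BoundedOrder L] :
    Lattice (FacePair L) :=
  letI := minInst L
  letI := maxInst L
  Lattice.mk'
    (fun _ _ => FacePair.ext (inf_comm _ _) (sup_comm _ _))
    (fun _ _ _ => FacePair.ext (inf_assoc _ _ _) (sup_assoc _ _ _))
    (fun _ _ => FacePair.ext (sup_comm _ _) (inf_comm _ _))
    (fun _ _ _ => FacePair.ext (sup_assoc _ _ _) (inf_assoc _ _ _))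
    (fun _ _ => FacePair.ext inf_sup_self sup_inf_self)
    (fun _ _ => FacePair.ext sup_inf_self inf_sup_self)

instance :
    DistribLattice (FacePair L) :=
  letI := latticeInst L
  DistribLattice.ofInfSupLe (fun _ _ _ =>
    le_of_eq (FacePair.ext (sup_inf_left _ _ _) (inf_sup_left _ _ _)))

/-- `(r ∨ s = 0) = (r = 0) ∧ (s = 0)`, `(r ∨ s = 1) = (r = 1) ∨ (s = 1)`, dually for `∧`, and
the involution exchanges `r = 0` and `r = 1`. -/
instance : DeMorganAlgebra (FacePair L) where
  top := ⟨⊥, ⊤, bot_inf_eq _⟩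
  bot := ⟨⊤, ⊥, inf_bot_eq _⟩
  le_top _ := inf_eq_left.1 (FacePair.ext (sup_bot_eq _) (inf_top_eq _))
  bot_le _ := sup_eq_left.1 (FacePair.ext (inf_top_eq _) (sup_bot_eq _))
  neg p := ⟨p.one, p.zero, by rw [inf_comm]; exact p.disj⟩
  neg_neg _ := rfl
  neg_sup _ _ := rfl

theorem inf_zero (p q : FacePair L) : (p ⊓ q).zero = p.zero ⊔ q.zero := rfl

theorem inf_one (p q : FacePair L) : (p ⊓ q).one = p.one ⊓ q.one := rfl

theorem sup_zero (p q : FacePair L) : (p ⊔ q).zero = p.zero ⊓ q.zero := rfl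

theorem sup_one (p q : FacePair L) : (p ⊔ q).one = p.one ⊔ q.one := rfl

theorem top_zero : (⊤ : FacePair L).zero = ⊥ := rfl

theorem top_one : (⊤ : FacePair L).one = ⊤ := rfl

theorem bot_zero : (⊥ : FacePair L).zero = ⊤ := rfl

theorem bot_one : (⊥ : FacePair L).one = ⊥ := rfl

theorem neg_zero (p : FacePair L) : (DeMorganAlgebra.neg p).zero = p.one := rfl

theorem neg_one (p : FacePair L) : (DeMorganAlgebra.neg p).one = p.zero := rfl

end FacePair

namespace Face

variable {n : ℕ}

/-- Evaluation of a face term, given values for the generating faces. -/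
def eval {L : Type*} [DistribLattice L] [BoundedOrder L] (f : Fin n → FacePair L) :
    FaceTerm n → L
  | .eqZero i => (f i).zero
  | .eqOne i => (f i).one
  | .bot => ⊥
  | .top => ⊤
  | .inf a b => eval f a ⊓ eval f b
  | .sup a b => eval f a ⊔ eval f b

theorem eval_rel {L : Type*} [DistribLattice L] [BoundedOrder L] (f : Fin n → FacePair L)
    {a b : FaceTerm n} (h : FaceTerm.Rel a b) : eval f a = eval f b := by
  induction h with
  | refl => rfl
  | symm _ ih => exact ih.symm
  | trans _ _ ih ih' => exact ih.trans ih'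
  | congr_inf _ _ ih ih' => simp only [eval, ih, ih']
  | congr_sup _ _ ih ih' => simp only [eval, ih, ih']
  | inf_comm => exact _root_.inf_comm _ _
  | sup_comm => exact _root_.sup_comm _ _
  | inf_assoc => exact _root_.inf_assoc _ _ _
  | sup_assoc => exact _root_.sup_assoc _ _ _
  | sup_inf_self => exact _root_.sup_inf_self
  | inf_sup_self => exact _root_.inf_sup_self
  | inf_sup_left => exact _root_.inf_sup_left _ _ _
  | sup_bot => exact sup_bot_eq _
  | inf_top => exact inf_top_eq _
  | disjoint i => exact (f i).disj

/-- The homomorphism of bounded lattices out of the face lattice determined by the images of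
the generating faces. -/
def lift {L : Type*} [DistribLattice L] [BoundedOrder L] (f : Fin n → FacePair L) :
    BoundedLatticeHom (Face n) L where
  toFun := Quotient.lift (eval f) fun _ _ h => eval_rel f h
  map_inf' := by rintro ⟨a⟩ ⟨b⟩; rfl
  map_sup' := by rintro ⟨a⟩ ⟨b⟩; rfl
  map_top' := rfl
  map_bot' := rfl

/-- Two homomorphisms that agree on the generating faces are equal. -/
theorem hom_ext {L : Type*} [DistribLattice L] [BoundedOrder L]
    (g h : BoundedLatticeHom (Face n) L)
    (e₀ : ∀ i, g (mk (.eqZero i)) = h (mk (.eqZero i)))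
    (e₁ : ∀ i, g (mk (.eqOne i)) = h (mk (.eqOne i))) (φ : Face n) : g φ = h φ := by
  obtain ⟨t⟩ := φ
  change g (mk t) = h (mk t)
  induction t with
  | eqZero i => exact e₀ i
  | eqOne i => exact e₁ i
  | bot => exact (map_bot g).trans (map_bot h).symm
  | top => exact (map_top g).trans (map_top h).symm
  | inf a b iha ihb =>
    change g (mk a ⊓ mk b) = h (mk a ⊓ mk b)
    rw [map_inf, map_inf, iha, ihb]
  | sup a b iha ihb =>
    change g (mk a ⊔ mk b) = h (mk a ⊔ mk b)
    rw [map_sup, map_sup, iha, ihb]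

/-- The pair of faces `((r = 0), (r = 1))` of an element `r` of the free De Morgan algebra. -/
def ofDM : BoundedLatticeHom (FreeDM n) (FacePair (Face n)) :=
  FreeDM.lift fun i => ⟨mk (.eqZero i), mk (.eqOne i), Face.disjoint i⟩

/-- The face `r = 0`. -/
def eqZero (r : FreeDM n) : Face n := (ofDM r).zero

/-- The face `r = 1`. -/
def eqOne (r : FreeDM n) : Face n := (ofDM r).one

/-- Substitution in faces: `(i = 0)` is sent to `(f i = 0)` and `(i = 1)` to `(f i = 1)`. -/
def subst {m : ℕ} (f : Fin n → FreeDM m) : BoundedLatticeHom (Face n) (Face m) :=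
  lift fun i => ofDM (f i)

theorem ofDM_neg (r : FreeDM n) : ofDM (DeMorganAlgebra.neg r) = DeMorganAlgebra.neg (ofDM r) :=
  FreeDM.lift_neg _ r

theorem ofDM_lift {m : ℕ} (f : Fin n → FreeDM m) (r : FreeDM n) :
    ofDM (FreeDM.lift f r) =
      ⟨subst f (eqZero r), subst f (eqOne r), by
        rw [← map_inf, show eqZero r ⊓ eqOne r = ⊥ from (ofDM r).disj, map_bot]⟩ := by
  refine FreeDM.hom_ext (fun r => ofDM (FreeDM.lift f r)) (fun r => (⟨subst f (eqZero r),
    subst f (eqOne r), by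
      rw [← map_inf, show eqZero r ⊓ eqOne r = ⊥ from (ofDM r).disj, map_bot]⟩ :
      FacePair (Face m))) ?_ ?_ ?_ ?_ ?_ ?_ ?_ ?_ ?_ ?_ ?_ r
  · simp
  · ext <;> simp [eqZero, eqOne, FacePair.bot_zero, FacePair.bot_one]
  · simp
  · ext <;> simp [eqZero, eqOne, FacePair.top_zero, FacePair.top_one]
  · simp
  · intro a b
    ext <;> simp [eqZero, eqOne, FacePair.inf_zero, FacePair.inf_one]
  · simp
  · intro a b
    ext <;> simp [eqZero, eqOne, FacePair.sup_zero, FacePair.sup_one]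
  · intro a
    simp only [ofDM_neg, FreeDM.lift_neg]
  · intro a
    ext <;> simp [eqZero, eqOne, ofDM_neg, FacePair.neg_zero, FacePair.neg_one]
  · intro i
    rfl

theorem eqZero_lift {m : ℕ} (f : Fin n → FreeDM m) (r : FreeDM n) :
    eqZero (FreeDM.lift f r) = subst f (eqZero r) := by
  rw [eqZero, ofDM_lift]

theorem eqOne_lift {m : ℕ} (f : Fin n → FreeDM m) (r : FreeDM n) :
    eqOne (FreeDM.lift f r) = subst f (eqOne r) := by
  rw [eqOne, ofDM_lift]

theorem subst_var (φ : Face n) : subst FreeDM.var φ = φ :=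
  hom_ext (subst FreeDM.var) (BoundedLatticeHom.id _) (fun _ => rfl) (fun _ => rfl) φ

theorem subst_subst {m k : ℕ} (f : Fin n → FreeDM m) (g : Fin m → FreeDM k) (φ : Face n) :
    subst g (subst f φ) = subst (fun i => FreeDM.lift g (f i)) φ :=
  hom_ext ((subst g).comp (subst f)) (subst fun i => FreeDM.lift g (f i))
    (fun i => (eqZero_lift g (f i)).symm) (fun i => (eqOne_lift g (f i)).symm) φ

end Face


/-! ### Internal lattices and De Morgan algebras

The equations are stated for generalized elements `Γ ⟶ X`, i.e. in the internal language. -/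

section Internal

universe v u v' u'

/-- A bounded distributive lattice object. -/
structure BDLObj (E : Type u) [Category.{v} E] [CartesianMonoidalCategory E] where
  X : E
  bot : 𝟙_ E ⟶ X
  top : 𝟙_ E ⟶ X
  inf : X ⊗ X ⟶ X
  sup : X ⊗ X ⟶ X
  inf_comm : ∀ {Γ : E} (a b : Γ ⟶ X), lift a b ≫ inf = lift b a ≫ inf
  sup_comm : ∀ {Γ : E} (a b : Γ ⟶ X), lift a b ≫ sup = lift b a ≫ sup
  inf_assoc : ∀ {Γ : E} (a b c : Γ ⟶ X),
    lift (lift a b ≫ inf) c ≫ inf = lift a (lift b c ≫ inf) ≫ inf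
  sup_assoc : ∀ {Γ : E} (a b c : Γ ⟶ X),
    lift (lift a b ≫ sup) c ≫ sup = lift a (lift b c ≫ sup) ≫ sup
  sup_inf_self : ∀ {Γ : E} (a b : Γ ⟶ X), lift a (lift a b ≫ inf) ≫ sup = a
  inf_sup_self : ∀ {Γ : E} (a b : Γ ⟶ X), lift a (lift a b ≫ sup) ≫ inf = a
  inf_sup_left : ∀ {Γ : E} (a b c : Γ ⟶ X),
    lift a (lift b c ≫ sup) ≫ inf = lift (lift a b ≫ inf) (lift a c ≫ inf) ≫ sup
  sup_bot : ∀ {Γ : E} (a : Γ ⟶ X), lift a (toUnit Γ ≫ bot) ≫ sup = a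
  inf_top : ∀ {Γ : E} (a : Γ ⟶ X), lift a (toUnit Γ ≫ top) ≫ inf = a

/-- A De Morgan algebra object. The endpoints `0`, `1` of an interval are `bot`, `top`, and the
involution `1 - r` is `neg`. -/
structure DeMorganObj (E : Type u) [Category.{v} E] [CartesianMonoidalCategory E] extends
    BDLObj E where
  neg : X ⟶ X
  neg_neg : neg ≫ neg = 𝟙 X
  neg_sup : ∀ {Γ : E} (a b : Γ ⟶ X),
    lift a b ≫ sup ≫ neg = lift (a ≫ neg) (b ≫ neg) ≫ inf

/-- For a functor `L` preserving finite products, `α : L A ≅ B` is an isomorphism of bounded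
distributive lattices, where `L A` carries the operations `L(∧)`, … transported along
`⟨L π₁, L π₂⟩ : L (A × A) ≅ L A × L A` and `L 1 ≅ 1`. -/
structure BDLObj.PreservedBy {E' : Type u'} [Category.{v'} E'] [CartesianMonoidalCategory E']
    {E : Type u} [Category.{v} E] [CartesianMonoidalCategory E] (L : E' ⥤ E)
    (A : BDLObj E') (B : BDLObj E) (α : L.obj A.X ≅ B.X) : Prop where
  bot : L.map A.bot ≫ α.hom = toUnit _ ≫ B.bot
  top : L.map A.top ≫ α.hom = toUnit _ ≫ B.top
  inf : L.map A.inf ≫ α.hom =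
    lift (L.map (fst A.X A.X) ≫ α.hom) (L.map (snd A.X A.X) ≫ α.hom) ≫ B.inf
  sup : L.map A.sup ≫ α.hom =
    lift (L.map (fst A.X A.X) ≫ α.hom) (L.map (snd A.X A.X) ≫ α.hom) ≫ B.sup

/-- The analogous notion of an isomorphism of De Morgan algebras `L A ≅ B`. -/
structure DeMorganObj.PreservedBy {E' : Type u'} [Category.{v'} E']
    [CartesianMonoidalCategory E'] {E : Type u} [Category.{v} E] [CartesianMonoidalCategory E]
    (L : E' ⥤ E) (A : DeMorganObj E') (B : DeMorganObj E) (α : L.obj A.X ≅ B.X) : Prop extends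
    BDLObj.PreservedBy L A.toBDLObj B.toBDLObj α where
  neg : L.map A.neg ≫ α.hom = α.hom ≫ B.neg

/-- The data carried by a LOPS topos besides its universes: an interval, which is a De Morgan
algebra, an object of cofibrations ("faces"), and the map `(- = 0)` from the former to the
latter. -/
structure CubicalStructure (E : Type u) [Category.{v} E] [CartesianMonoidalCategory E] where
  interval : DeMorganObj E
  face : BDLObj E
  eqZero : interval.X ⟶ face.X

/-- A morphism of LOPS topoi: an adjunction `L ⊣ R` with `R : E ⥤ E'` whose left adjoint is lex,
i.e. a geometric morphism, together with compatible isomorphisms `α : L 𝕀' ≅ 𝕀` of De Morgan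
algebras and `β : L Φ' ≅ Φ` of bounded distributive lattices. -/
structure LOPSMorphism {E' : Type u'} [Category.{v'} E'] [CartesianMonoidalCategory E']
    {E : Type u} [Category.{v} E] [CartesianMonoidalCategory E]
    (S' : CubicalStructure E') (S : CubicalStructure E)
    {L : E' ⥤ E} {R : E ⥤ E'} (_adj : L ⊣ R) where
  lex : PreservesFiniteLimits L
  α : L.obj S'.interval.X ≅ S.interval.X
  β : L.obj S'.face.X ≅ S.face.X
  α_deMorgan : DeMorganObj.PreservedBy L S'.interval S.interval α
  β_lattice : BDLObj.PreservedBy L S'.face S.face β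
  compat : L.map S'.eqZero ≫ β.hom = α.hom ≫ S.eqZero

end Internal

/-! ### Universes in a topos -/

section Topos

universe v u

variable {E : Type u} [Category.{v} E] [CartesianMonoidalCategory E]

theorem mono_of_unit {X : E} (f : 𝟙_ E ⟶ X) : Mono f :=
  ⟨fun _ _ _ => toUnit_unique _ _⟩

/-- A natural numbers object. -/
def IsNNO {N : E} (zero : 𝟙_ E ⟶ N) (succ : N ⟶ N) : Prop :=
  ∀ (X : E) (x : 𝟙_ E ⟶ X) (t : X ⟶ X), ∃! h : N ⟶ X, zero ≫ h = x ∧ succ ≫ h = h ≫ t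

/-- A generic family `π : El ⟶ U`. -/
structure GenericFamily (E : Type u) [Category.{v} E] where
  El : E
  U : E
  π : El ⟶ U

/-- The families classified by `π : El ⟶ U`: the pullbacks of `π`. -/
def GenericFamily.Small {E : Type u} [Category.{v} E] (u : GenericFamily E) :
    MorphismProperty E :=
  fun A X f => ∃ (a : X ⟶ u.U) (b : A ⟶ u.El), IsPullback b f u.π a

/-- A universe in a topos: a generic family whose class of small maps (which is stable under
pullback by construction) contains all monomorphisms, is closed under composition (dependent
sums) and dependent products, and for which the subobject classifier and a natural numbers
object are small. Since the diagonals are monomorphisms and `1 + 1` is a subobject of `Ω`,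
extensional identity types and booleans are included. -/
structure GenericFamily.IsUniverse [HasFiniteLimits E] [HasSubobjectClassifier E]
    (u : GenericFamily E) : Prop where
  small_of_mono : ∀ {A X : E} (m : A ⟶ X) [Mono m], u.Small m
  small_comp : ∀ {B A X : E} (g : B ⟶ A) (f : A ⟶ X), u.Small g → u.Small f → u.Small (g ≫ f)
  /-- The dependent product `h` of `g` along `f` exists and is small: morphisms `Y ⟶ h` over `X`
  correspond, naturally in `Y`, to morphisms `f^* Y ⟶ g` over `A`. -/
  small_pi : ∀ {B A X : E} (g : B ⟶ A) (f : A ⟶ X), u.Small g → u.Small f →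
    ∃ h : Over X, u.Small h.hom ∧
      Nonempty (((Over.pullback f).op ⋙ yoneda.obj (Over.mk g)).RepresentableBy h)
  small_Ω : u.Small (toUnit (HasSubobjectClassifier.Ω E))
  small_nat : ∃ (N : E) (zero : 𝟙_ E ⟶ N) (succ : N ⟶ N), IsNNO zero succ ∧ u.Small (toUnit N)

/-- A (cumulative) hierarchy of universes indexed by `J`: for `i < j`, the `i`-th universe is an
element of the `j`-th one and every `i`-small family is `j`-small. -/
structure IsUniverseHierarchy [HasFiniteLimits E] [HasSubobjectClassifier E]
    {J : Type*} [LinearOrder J] (u : J → GenericFamily E) : Prop where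
  isUniverse : ∀ j, (u j).IsUniverse
  small_U : ∀ {i j : J}, i < j → (u j).Small (toUnit (u i).U)
  small_le : ∀ {i j : J}, i < j → (u i).Small ≤ (u j).Small

/-! ### LOPS topoi -/

namespace CubicalStructure

/-- The classifying map `Φ ⟶ Ω` of `⊤ : 1 ⟶ Φ`. Any monomorphism `Φ ⟶ Ω` which preserves `⊤` is
equal to this map. -/
noncomputable def faceEmb [HasSubobjectClassifier E] (S : CubicalStructure E) :
    S.face.X ⟶ HasSubobjectClassifier.Ω E :=
  haveI := mono_of_unit S.face.top
  HasSubobjectClassifier.χ S.face.top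

/-- The subobject `{φ}` of `Γ` given by a face `φ : Γ ⟶ Φ`: the pullback of `⊤ : 1 ⟶ Φ`. -/
noncomputable def faceSub [HasFiniteLimits E] (S : CubicalStructure E) {Γ : E}
    (φ : Γ ⟶ S.face.X) : Subobject Γ :=
  haveI := mono_of_unit S.face.top
  (Subobject.pullback φ).obj (Subobject.mk S.face.top)

/-- A subobject is cofibrant (`cof φ` in the internal language) if its classifying map factors
through `Φ ⟶ Ω`. -/
def IsCof [HasSubobjectClassifier E] (S : CubicalStructure E) {X : E} (φ : Subobject X) : Prop :=
  ∃ a : X ⟶ S.face.X, a ≫ S.faceEmb = HasSubobjectClassifier.χ φ.arrow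

/-- The strictness axiom for a universe `U`: if a small family `p` over `X` is, over a cofibrant
subobject `m` of `X`, isomorphic to a family named by `a : S ⟶ U`, then `p` is isomorphic to a
family named by some `b : X ⟶ U` which restricts to `a` on the nose, by an isomorphism extending
the given one. (Isomorphisms of a family with the one named by `a` are the same as maps `a'` that
make a pullback square over `a`.) -/
def Strictness [HasSubobjectClassifier E] (S : CubicalStructure E) (u : GenericFamily E) : Prop :=
  ∀ {Z X Q P : E} (m : Z ⟶ X) [Mono m] (p : P ⟶ X) (q : Q ⟶ Z) (i : Q ⟶ P),
    S.IsCof (Subobject.mk m) → IsPullback i q p m → u.Small p →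
    ∀ (a : Z ⟶ u.U) (a' : Q ⟶ u.El), IsPullback a' q u.π a →
      ∃ (b : X ⟶ u.U) (b' : P ⟶ u.El), IsPullback b' p u.π b ∧ m ≫ b = a ∧ i ≫ b' = a'

/-- `E` is an elementary topos by the type class arguments. This predicate says that it is a LOPS
topos with the given interval and cofibrations and with a hierarchy of universes indexed by `J`.
The axioms, which belong to the internal language of `E`, are spelled out by Kripke–Joyal
semantics: `⊓`, binary least upper bounds and the least element in the posets of subobjects
interpret `∧`, `∨`, `⊥`, and the greatest `θ` with `π₁^* θ ≤ φ` interprets `∀ i : 𝕀, φ i`. That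
`𝕀` has connections is part of it being a De Morgan algebra. -/
structure IsLOPSTopos (J : Type*) [LinearOrder J] [MonoidalClosed E] [HasFiniteLimits E]
    [HasSubobjectClassifier E] (S : CubicalStructure E) : Prop where
  /-- `Φ` is a subobject of `Ω` ... -/
  mono_faceEmb : Mono S.faceEmb
  /-- ... with the lattice structure inherited from `Ω` -/
  face_bot : ∀ Γ : E, IsBot (S.faceSub (toUnit Γ ≫ S.face.bot))
  face_inf : ∀ {Γ : E} (φ ψ : Γ ⟶ S.face.X),
    S.faceSub (lift φ ψ ≫ S.face.inf) = S.faceSub φ ⊓ S.faceSub ψ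
  face_sup : ∀ {Γ : E} (φ ψ : Γ ⟶ S.face.X),
    IsLUB {S.faceSub φ, S.faceSub ψ} (S.faceSub (lift φ ψ ≫ S.face.sup))
  /-- `(- = 0)` is the proposition that an element of `𝕀` is equal to `0` -/
  eqZero_spec : ∀ {Γ : E} (r : Γ ⟶ S.interval.X),
    S.faceSub (r ≫ S.eqZero) = Subobject.mk (equalizer.ι r (toUnit Γ ≫ S.interval.bot))
  /-- `𝕀` is connected: `(∀ i, φ i ∨ ¬ φ i) → (∀ i, φ i) ∨ (∀ i, ¬ φ i)` -/
  connected : ∀ {X : E} (φ ψ : Subobject (X ⊗ S.interval.X)), IsLUB {φ, ψ} ⊤ → IsBot (φ ⊓ ψ) →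
    ∃ θ₀ θ₁ : Subobject X, IsLUB {θ₀, θ₁} ⊤ ∧
      (Subobject.pullback (fst X S.interval.X)).obj θ₀ ≤ φ ∧
      (Subobject.pullback (fst X S.interval.X)).obj θ₁ ≤ ψ
  /-- `¬ (0 = 1)` -/
  zero_ne_one : ∀ Γ : E, toUnit Γ ≫ S.interval.bot = toUnit Γ ≫ S.interval.top →
    Nonempty (IsInitial Γ)
  /-- `cof (i = 0)` -/
  cof_eq_zero : ∀ {Γ : E} (r : Γ ⟶ S.interval.X),
    S.IsCof (Subobject.mk (equalizer.ι r (toUnit Γ ≫ S.interval.bot)))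
  /-- `cof (i = 1)` -/
  cof_eq_one : ∀ {Γ : E} (r : Γ ⟶ S.interval.X),
    S.IsCof (Subobject.mk (equalizer.ι r (toUnit Γ ≫ S.interval.top)))
  /-- `cof φ → cof ψ → cof (φ ∨ ψ)` -/
  cof_or : ∀ {X : E} (φ ψ χ : Subobject X), S.IsCof φ → S.IsCof ψ → IsLUB {φ, ψ} χ → S.IsCof χ
  /-- `cof φ → (φ → cof ψ) → cof (φ ∧ ψ)` -/
  cof_and : ∀ {X : E} (φ ψ : Subobject X), S.IsCof φ →
    S.IsCof ((Subobject.pullback φ.arrow).obj ψ) → S.IsCof (φ ⊓ ψ)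
  /-- `(∀ i, cof (φ i)) → cof (∀ i, φ i)` -/
  cof_forall : ∀ {X : E} (φ : Subobject (X ⊗ S.interval.X)) (ψ : Subobject X), S.IsCof φ →
    IsGreatest {θ | (Subobject.pullback (fst X S.interval.X)).obj θ ≤ φ} ψ → S.IsCof ψ
  /-- `𝕀` is tiny: exponentiation by `𝕀` has a right adjoint -/
  tiny : (ihom S.interval.X).IsLeftAdjoint
  /-- the hierarchy of universes, containing `𝕀` and satisfying the strictness axiom -/
  universes : ∃ u : J → GenericFamily E, IsUniverseHierarchy u ∧
    ∀ j, (u j).Small (toUnit S.interval.X) ∧ S.Strictness (u j)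

end CubicalStructure

end Topos

/-! ### Presheaves on `C × Cube` -/

section Presheaf

/-- The interval in cubical sets: `n ↦` the free De Morgan algebra on `n` generators, with
substitution as restriction. -/
def cubeInterval : Cubeᵒᵖ ⥤ Type w where
  obj X := ULift.{w} (FreeDM X.unop.dim)
  map f := ↾fun r => ⟨FreeDM.lift f.unop r.down⟩
  map_id X := by
    ext r
    exact FreeDM.lift_var_self r.down
  map_comp f g := by
    ext r
    exact (FreeDM.lift_lift f.unop g.unop r.down).symm

/-- The face lattice in cubical sets. -/
def cubeFace : Cubeᵒᵖ ⥤ Type w where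
  obj X := ULift.{w} (Face X.unop.dim)
  map f := ↾fun φ => ⟨Face.subst f.unop φ.down⟩
  map_id X := by
    ext φ
    exact Face.subst_var φ.down
  map_comp f g := by
    ext φ
    exact (Face.subst_subst f.unop g.unop φ.down).symm

/-- Presheaves on `C × Cube`. -/
abbrev CubicalPSh (C : Type w) [SmallCategory C] := (C × Cube)ᵒᵖ ⥤ Type w

variable (C : Type w) [SmallCategory C]

/-- The interval of `CubicalPSh C`, constant in `C`, with the pointwise operations. -/
def presheafInterval : DeMorganObj (CubicalPSh C) where
  X := (CategoryTheory.Prod.snd C Cube).op ⋙ cubeInterval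
  bot :=
    { app _ := ↾fun _ => ⟨⊥⟩
      naturality _ _ f := by
        ext
        exact congrArg ULift.up (map_bot (FreeDM.lift f.unop.2)).symm }
  top :=
    { app _ := ↾fun _ => ⟨⊤⟩
      naturality _ _ f := by
        ext
        exact congrArg ULift.up (map_top (FreeDM.lift f.unop.2)).symm }
  inf :=
    { app _ := ↾fun p => ⟨p.1.down ⊓ p.2.down⟩
      naturality _ _ f := by
        ext p
        exact congrArg ULift.up ((FreeDM.lift f.unop.2).map_inf' p.1.down p.2.down).symm }
  sup :=
    { app _ := ↾fun p => ⟨p.1.down ⊔ p.2.down⟩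
      naturality _ _ f := by
        ext p
        exact congrArg ULift.up ((FreeDM.lift f.unop.2).map_sup' p.1.down p.2.down).symm }
  neg :=
    { app _ := ↾fun r => ⟨DeMorganAlgebra.neg r.down⟩
      naturality _ _ f := by
        ext r
        exact congrArg ULift.up (FreeDM.lift_neg f.unop.2 r.down).symm }
  inf_comm a b := by
    ext X x
    exact congrArg ULift.up (_root_.inf_comm (a.app X x).down (b.app X x).down)
  sup_comm a b := by
    ext X x
    exact congrArg ULift.up (_root_.sup_comm (a.app X x).down (b.app X x).down)
  inf_assoc a b c := by
    ext X x
    exact congrArg ULift.up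
      (_root_.inf_assoc (a.app X x).down (b.app X x).down (c.app X x).down)
  sup_assoc a b c := by
    ext X x
    exact congrArg ULift.up
      (_root_.sup_assoc (a.app X x).down (b.app X x).down (c.app X x).down)
  sup_inf_self a b := by
    ext X x
    exact congrArg ULift.up
      (_root_.sup_inf_self (a := (a.app X x).down) (b := (b.app X x).down))
  inf_sup_self a b := by
    ext X x
    exact congrArg ULift.up
      (_root_.inf_sup_self (a := (a.app X x).down) (b := (b.app X x).down))
  inf_sup_left a b c := by
    ext X x
    exact congrArg ULift.up
      (_root_.inf_sup_left (a.app X x).down (b.app X x).down (c.app X x).down)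
  sup_bot a := by
    ext X x
    exact congrArg ULift.up (sup_bot_eq (a.app X x).down)
  inf_top a := by
    ext X x
    exact congrArg ULift.up (inf_top_eq (a.app X x).down)
  neg_neg := by
    ext X x
    exact congrArg ULift.up (DeMorganAlgebra.neg_neg x.down)
  neg_sup a b := by
    ext X x
    exact congrArg ULift.up (DeMorganAlgebra.neg_sup (a.app X x).down (b.app X x).down)

/-- The face lattice of `CubicalPSh C`, constant in `C`, with the pointwise operations. -/
def presheafFace : BDLObj (CubicalPSh C) where
  X := (CategoryTheory.Prod.snd C Cube).op ⋙ cubeFace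
  bot :=
    { app _ := ↾fun _ => ⟨⊥⟩
      naturality _ _ f := by
        ext
        exact congrArg ULift.up (map_bot (Face.subst f.unop.2)).symm }
  top :=
    { app _ := ↾fun _ => ⟨⊤⟩
      naturality _ _ f := by
        ext
        exact congrArg ULift.up (map_top (Face.subst f.unop.2)).symm }
  inf :=
    { app _ := ↾fun p => ⟨p.1.down ⊓ p.2.down⟩
      naturality _ _ f := by
        ext p
        exact congrArg ULift.up ((Face.subst f.unop.2).map_inf' p.1.down p.2.down).symm }
  sup :=
    { app _ := ↾fun p => ⟨p.1.down ⊔ p.2.down⟩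
      naturality _ _ f := by
        ext p
        exact congrArg ULift.up ((Face.subst f.unop.2).map_sup' p.1.down p.2.down).symm }
  inf_comm a b := by
    ext X x
    exact congrArg ULift.up (_root_.inf_comm (a.app X x).down (b.app X x).down)
  sup_comm a b := by
    ext X x
    exact congrArg ULift.up (_root_.sup_comm (a.app X x).down (b.app X x).down)
  inf_assoc a b c := by
    ext X x
    exact congrArg ULift.up
      (_root_.inf_assoc (a.app X x).down (b.app X x).down (c.app X x).down)
  sup_assoc a b c := by
    ext X x
    exact congrArg ULift.up
      (_root_.sup_assoc (a.app X x).down (b.app X x).down (c.app X x).down)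
  sup_inf_self a b := by
    ext X x
    exact congrArg ULift.up
      (_root_.sup_inf_self (a := (a.app X x).down) (b := (b.app X x).down))
  inf_sup_self a b := by
    ext X x
    exact congrArg ULift.up
      (_root_.inf_sup_self (a := (a.app X x).down) (b := (b.app X x).down))
  inf_sup_left a b c := by
    ext X x
    exact congrArg ULift.up
      (_root_.inf_sup_left (a.app X x).down (b.app X x).down (c.app X x).down)
  sup_bot a := by
    ext X x
    exact congrArg ULift.up (sup_bot_eq (a.app X x).down)
  inf_top a := by
    ext X x
    exact congrArg ULift.up (inf_top_eq (a.app X x).down)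

/-- The interval and the face lattice of `CubicalPSh C`; `r ↦ (r = 0)` is pointwise the map
extending `i ↦ (i = 0)`. -/
def presheafCubical : CubicalStructure (CubicalPSh C) where
  interval := presheafInterval C
  face := presheafFace C
  eqZero :=
    { app _ := ↾fun r => ⟨Face.eqZero r.down⟩
      naturality _ _ f := by
        ext r
        exact congrArg ULift.up (Face.eqZero_lift f.unop.2 r.down) }

variable {C}

/-- The functor `F × id` (on opposite categories) along which presheaves are restricted and Kan
extended. -/
abbrev timesCube {D : Type w} [SmallCategory D] (F : C ⥤ D) : (C × Cube)ᵒᵖ ⥤ (D × Cube)ᵒᵖ :=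
  (F.prod (𝟭 Cube)).op

end Presheaf

end LOPS

/-!
Restriction along a map of `C × Cube` acts on the interval and on the faces through its second
component only, and this reduces most of the theorem to the combinatorics of free De Morgan
algebras and of the face lattice, and to the usual set-theoretic universes of presheaves.

*Faces.* Evaluation at the generic point of a cube is a homomorphism from the face lattice to
`Prop` which detects `⊤` (`Face.generic_iff`); hence `⊤` is join-prime, and `(r = 0)` is `⊤` only
for `r = ⊥`. Every face is a finite join of cells (`Face.isJoinOfCells`), and a cell is the image of
an idempotent endomorphism of the cube, so a face is determined by the sieve of maps which land in
it (`Face.ext_subst`). Thus faces embed in the subobject classifier, and a subobject is cofibrant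
iff each element of the ambient presheaf belongs to it along the sieve of some face
(`isCof_iff_exists_face`). In this form each of the axioms on cofibrations is a construction of a
face: `cof_and` restricts along the retractions onto the cells (`exists_face_inf`), and `cof_forall`
drops the cells which mention the bound variable (`Face.subst_forallZero`).

*Interval.* The product of a representable presheaf with the interval is representable, by the cube
with one more dimension. Therefore a statement about all points of the interval is one about the
generic point, which gives connectedness (`interval_connected`), and exponentiation by the interval
is restriction along adding a dimension, which has a right Kan extension (`interval_tiny`).

*Universes.* For a cardinal `κ`, consider the presheaf `cofree K κ.out`. A family whose fibres have
fewer than `κ` elements embeds fibrewise in it, because a map into it can be chosen element by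
element. The set of small families over the representable of `c` is thus replaced by the set of
those subpresheaves of its product with `cofree K κ.out` which have small fibres (`SmallFamily`);
restriction of these is strictly functorial. The same freedom of choice shows that codes given over
a subobject extend (`exists_extension`). This is the strictness axiom, and its case of the empty
subobject says that the small maps are those with fibres of cardinality less than `κ`
(`small_iff`). The closure properties then are facts about inaccessible cardinals.

*Morphisms.* The interval and the faces are constant in the first variable, so restriction along
`F × id` preserves them on the nose. For a left exact left adjoint of restriction the matter is
whether the counit is invertible at presheaves `constantIn D Z`, i.e. whether restriction is
bijective on the maps out of them. Since maps `constantIn D Z ⟶ Y` are the global elements of the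
presheaf `sliceHom Z Y`, it suffices that restriction is bijective on global elements
(`bijective_restriction_map`), and this holds as the left adjoint preserves the terminal object.
-/

namespace LOPS

/-! ### Countability of free De Morgan algebras -/

/-- The code of a term as a natural number. -/
def DMTerm.code {n : ℕ} : DMTerm n → ℕ
  | .var i => Nat.pair 0 i
  | .bot => Nat.pair 1 0
  | .top => Nat.pair 2 0
  | .inf a b => Nat.pair 3 (Nat.pair a.code b.code)
  | .sup a b => Nat.pair 4 (Nat.pair a.code b.code)
  | .neg a => Nat.pair 5 a.code

theorem DMTerm.code_injective {n : ℕ} : Function.Injective (DMTerm.code (n := n)) := by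
  intro a
  induction a with
  | var i => intro b h; cases b <;> simp_all [code, Nat.pair_eq_pair, Fin.ext_iff]
  | bot => intro b h; cases b <;> simp_all [code, Nat.pair_eq_pair]
  | top => intro b h; cases b <;> simp_all [code, Nat.pair_eq_pair]
  | inf a a' ih ih' =>
    intro b h
    cases b <;> simp only [code, Nat.pair_eq_pair] at h <;> first | omega | skip
    rw [ih h.2.1, ih' h.2.2]
  | sup a a' ih ih' =>
    intro b h
    cases b <;> simp only [code, Nat.pair_eq_pair] at h <;> first | omega | skip
    rw [ih h.2.1, ih' h.2.2]
  | neg a ih =>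
    intro b h
    cases b <;> simp only [code, Nat.pair_eq_pair] at h <;> first | omega | skip
    rw [ih h.2]

instance (n : ℕ) : Countable (FreeDM n) :=
  haveI : Countable (DMTerm n) := DMTerm.code_injective.countable
  Quotient.countable

/-! ### Truth and the disjunction property in the face lattice -/

namespace FreeDM

variable {n m : ℕ}

theorem bot_ne_top : (⊥ : FreeDM n) ≠ ⊤ := fun h => by
  have := congrArg (fun r => (lift (fun _ => (⊥ : FacePair Prop)) r).one) h
  simp [FacePair.bot_one, FacePair.top_one] at this

/-- The map of cubes `f × id`, whose new dimension is numbered `0`. -/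
def underCons (f : Fin n → FreeDM m) : Fin (n + 1) → FreeDM (m + 1) :=
  Fin.cons (var 0) fun i => lift (fun j => var j.succ) (f i)

theorem underCons_var (n : ℕ) : underCons (var (n := n)) = var := by
  funext i
  induction i using Fin.cases with
  | zero => rfl
  | succ i => rfl

theorem underCons_lift {k : ℕ} (f : Fin n → FreeDM m) (g : Fin m → FreeDM k) :
    underCons (fun i => lift g (f i)) = fun i => lift (underCons g) (underCons f i) := by
  funext i
  induction i using Fin.cases with
  | zero => rfl
  | succ i =>
    exact (lift_lift g (fun j => var j.succ) (f i)).trans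
      (lift_lift (fun j => var j.succ) (underCons g) (f i)).symm

end FreeDM

namespace Face

variable {n m : ℕ}

theorem induction_on {P : Face n → Prop} (φ : Face n) (eqZero : ∀ i, P (mk (.eqZero i)))
    (eqOne : ∀ i, P (mk (.eqOne i))) (bot : P ⊥) (top : P ⊤)
    (inf : ∀ a b, P a → P b → P (a ⊓ b)) (sup : ∀ a b, P a → P b → P (a ⊔ b)) : P φ := by
  obtain ⟨t⟩ := φ
  change P (mk t)
  induction t with
  | eqZero i => exact eqZero i
  | eqOne i => exact eqOne i
  | bot => exact bot
  | top => exact top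
  | inf a b iha ihb => exact inf _ _ iha ihb
  | sup a b iha ihb => exact sup _ _ iha ihb

@[simp]
theorem subst_eqZero (f : Fin n → FreeDM m) (i : Fin n) :
    subst f (mk (.eqZero i)) = eqZero (f i) := rfl

@[simp]
theorem subst_eqOne (f : Fin n → FreeDM m) (i : Fin n) :
    subst f (mk (.eqOne i)) = eqOne (f i) := rfl

theorem eqZero_inf (r s : FreeDM n) : eqZero (r ⊓ s) = eqZero r ⊔ eqZero s := by
  simp [eqZero, FacePair.inf_zero]

theorem eqZero_sup (r s : FreeDM n) : eqZero (r ⊔ s) = eqZero r ⊓ eqZero s := by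
  simp [eqZero, FacePair.sup_zero]

theorem eqOne_inf (r s : FreeDM n) : eqOne (r ⊓ s) = eqOne r ⊓ eqOne s := by
  simp [eqOne, FacePair.inf_one]

theorem eqOne_sup (r s : FreeDM n) : eqOne (r ⊔ s) = eqOne r ⊔ eqOne s := by
  simp [eqOne, FacePair.sup_one]

@[simp]
theorem eqZero_bot : eqZero (⊥ : FreeDM n) = ⊤ := by simp [eqZero, FacePair.bot_zero]

@[simp]
theorem eqZero_top : eqZero (⊤ : FreeDM n) = ⊥ := by simp [eqZero, FacePair.top_zero]

@[simp]
theorem eqOne_bot : eqOne (⊥ : FreeDM n) = ⊥ := by simp [eqOne, FacePair.bot_one]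

@[simp]
theorem eqOne_top : eqOne (⊤ : FreeDM n) = ⊤ := by simp [eqOne, FacePair.top_one]

theorem eqZero_neg (r : FreeDM n) : eqZero (DeMorganAlgebra.neg r) = eqOne r := by
  simp [eqZero, eqOne, ofDM_neg, FacePair.neg_zero]

theorem eqOne_neg (r : FreeDM n) : eqOne (DeMorganAlgebra.neg r) = eqZero r := by
  simp [eqZero, eqOne, ofDM_neg, FacePair.neg_one]

/-- The truth value of a face at the generic point of the cube, where all the faces `i = 0` and
`i = 1` are false. -/
def generic : BoundedLatticeHom (Face n) Prop :=
  lift fun _ => ⟨⊥, ⊥, bot_inf_eq _⟩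

/-- A face is `⊤` as soon as it holds at the generic point. That truth at the generic point is
a homomorphism to `Prop` then yields the disjunction property of the face lattice. -/
theorem generic_iff (φ : Face n) : generic φ ↔ φ = ⊤ := by
  refine ⟨fun h => ?_, fun h => by simp [h]⟩
  induction φ using induction_on with
  | eqZero i => exact h.elim
  | eqOne i => exact h.elim
  | bot => simp at h
  | top => rfl
  | inf a b iha ihb =>
    rw [map_inf] at h
    rw [iha h.1, ihb h.2, inf_top_eq]
  | sup a b iha ihb =>
    rw [map_sup] at h
    rcases h with h | h
    · rw [iha h, top_sup_eq]
    · rw [ihb h, sup_top_eq]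

theorem sup_eq_top_iff (φ ψ : Face n) : φ ⊔ ψ = ⊤ ↔ φ = ⊤ ∨ ψ = ⊤ := by
  rw [← generic_iff, map_sup, ← generic_iff, ← generic_iff]
  rfl

theorem bot_ne_top : (⊥ : Face n) ≠ ⊤ := fun h => by
  have := (generic_iff (⊥ : Face n)).2 h
  simp at this

theorem eq_bot_of_eqZero_and_eq_top_of_eqOne (r : FreeDM n) :
    (eqZero r = ⊤ → r = ⊥) ∧ (eqOne r = ⊤ → r = ⊤) := by
  obtain ⟨t⟩ := r
  change (eqZero (FreeDM.mk t) = ⊤ → FreeDM.mk t = ⊥) ∧ (eqOne (FreeDM.mk t) = ⊤ → FreeDM.mk t = ⊤)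
  induction t with
  | var i => exact ⟨fun h => ((generic_iff _).2 h).elim, fun h => ((generic_iff _).2 h).elim⟩
  | bot => exact ⟨fun _ => rfl, fun h => (bot_ne_top (eqOne_bot.symm.trans h)).elim⟩
  | top => exact ⟨fun h => (bot_ne_top (eqZero_top.symm.trans h)).elim, fun _ => rfl⟩
  | inf a b iha ihb =>
    change (eqZero (FreeDM.mk a ⊓ FreeDM.mk b) = ⊤ → FreeDM.mk a ⊓ FreeDM.mk b = ⊥) ∧
      (eqOne (FreeDM.mk a ⊓ FreeDM.mk b) = ⊤ → FreeDM.mk a ⊓ FreeDM.mk b = ⊤)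
    rw [eqZero_inf, eqOne_inf, sup_eq_top_iff, inf_eq_top_iff]
    refine ⟨?_, fun h => by rw [iha.2 h.1, ihb.2 h.2, inf_top_eq]⟩
    rintro (h | h)
    · rw [iha.1 h, bot_inf_eq]
    · rw [ihb.1 h, inf_bot_eq]
  | sup a b iha ihb =>
    change (eqZero (FreeDM.mk a ⊔ FreeDM.mk b) = ⊤ → FreeDM.mk a ⊔ FreeDM.mk b = ⊥) ∧
      (eqOne (FreeDM.mk a ⊔ FreeDM.mk b) = ⊤ → FreeDM.mk a ⊔ FreeDM.mk b = ⊤)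
    rw [eqZero_sup, eqOne_sup, sup_eq_top_iff, inf_eq_top_iff]
    refine ⟨fun h => by rw [iha.1 h.1, ihb.1 h.2, sup_bot_eq], ?_⟩
    rintro (h | h)
    · rw [iha.2 h, top_sup_eq]
    · rw [ihb.2 h, sup_top_eq]
  | neg a iha =>
    change (eqZero (DeMorganAlgebra.neg (FreeDM.mk a)) = ⊤ →
        DeMorganAlgebra.neg (FreeDM.mk a) = ⊥) ∧
      (eqOne (DeMorganAlgebra.neg (FreeDM.mk a)) = ⊤ → DeMorganAlgebra.neg (FreeDM.mk a) = ⊤)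
    rw [eqZero_neg, eqOne_neg]
    exact ⟨fun h => by rw [iha.2 h, DeMorganAlgebra.neg_top],
      fun h => by rw [iha.1 h, DeMorganAlgebra.neg_bot]⟩

theorem eqZero_eq_top_iff (r : FreeDM n) : eqZero r = ⊤ ↔ r = ⊥ :=
  ⟨(eq_bot_of_eqZero_and_eq_top_of_eqOne r).1, fun h => h ▸ eqZero_bot⟩

theorem eqOne_eq_top_iff (r : FreeDM n) : eqOne r = ⊤ ↔ r = ⊤ :=
  ⟨(eq_bot_of_eqZero_and_eq_top_of_eqOne r).2, fun h => h ▸ eqOne_top⟩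

theorem var_ne_bot (i : Fin n) : FreeDM.var i ≠ ⊥ := fun h => by
  have := (generic_iff _).2 ((eqZero_eq_top_iff _).2 h)
  exact this

theorem var_ne_top (i : Fin n) : FreeDM.var i ≠ ⊤ := fun h => by
  have := (generic_iff _).2 ((eqOne_eq_top_iff _).2 h)
  exact this

/-! ### Disjunctive normal forms of faces -/

/-- `α` is an intersection of consistent faces `i = 0`, `i = 1`, and `e` is the idempotent
endomorphism of the cube with image `α`: it sets the coordinates to the endpoints that `α`
prescribes and keeps the others. -/
structure IsCell (α : Face n) (e : Fin n → FreeDM n) : Prop where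
  cases : ∀ i, e i = ⊥ ∨ e i = ⊤ ∨ e i = FreeDM.var i
  subst_self : subst e α = ⊤
  le_zero : ∀ i, e i = ⊥ → α ≤ mk (.eqZero i)
  le_one : ∀ i, e i = ⊤ → α ≤ mk (.eqOne i)

namespace IsCell

variable {α β : Face n} {e e' : Fin n → FreeDM n}

theorem inf_subst_le (h : IsCell α e) (ψ : Face n) : α ⊓ subst e ψ ≤ ψ := by
  induction ψ using induction_on with
  | eqZero i =>
    rw [subst_eqZero]
    rcases h.cases i with hi | hi | hi
    · exact inf_le_left.trans (h.le_zero i hi)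
    · rw [hi, eqZero_top, inf_bot_eq]; exact bot_le
    · rw [hi]; exact inf_le_right
  | eqOne i =>
    rw [subst_eqOne]
    rcases h.cases i with hi | hi | hi
    · rw [hi, eqOne_bot, inf_bot_eq]; exact bot_le
    · exact inf_le_left.trans (h.le_one i hi)
    · rw [hi]; exact inf_le_right
  | bot => simp
  | top => exact le_top
  | inf a b iha ihb =>
    rw [map_inf]
    exact le_inf ((inf_le_inf_left _ inf_le_left).trans iha)
      ((inf_le_inf_left _ inf_le_right).trans ihb)
  | sup a b iha ihb =>
    rw [map_sup, inf_sup_left]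
    exact sup_le_sup iha ihb

/-- A map into the cube which lands in the face `α` is fixed by the retraction onto `α`. -/
theorem lift_eq (h : IsCell α e) (f : Fin n → FreeDM m) (hf : subst f α = ⊤) (i : Fin n) :
    FreeDM.lift f (e i) = f i := by
  rcases h.cases i with hi | hi | hi
  · have h' := OrderHomClass.mono (subst f) (h.le_zero i hi)
    rw [hf, top_le_iff, subst_eqZero, eqZero_eq_top_iff] at h'
    rw [hi, h', map_bot]
  · have h' := OrderHomClass.mono (subst f) (h.le_one i hi)
    rw [hf, top_le_iff, subst_eqOne, eqOne_eq_top_iff] at h'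
    rw [hi, h', map_top]
  · rw [hi, FreeDM.lift_var]

theorem subst_eq_top_of_lift_eq (h : IsCell α e) (f : Fin n → FreeDM m)
    (hf : ∀ i, FreeDM.lift f (e i) = f i) : subst f α = ⊤ := by
  rw [show f = fun i => FreeDM.lift f (e i) from funext fun i => (hf i).symm, ← subst_subst,
    h.subst_self, map_top]

open Classical in
theorem inf (h : IsCell α e) (h' : IsCell β e') :
    α ⊓ β = ⊥ ∨ ∃ e'', IsCell (α ⊓ β) e'' := by
  by_cases hc : ∃ i, (e i = ⊥ ∧ e' i = ⊤) ∨ (e i = ⊤ ∧ e' i = ⊥)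
  · left
    obtain ⟨i, ⟨h₀, h₁⟩ | ⟨h₁, h₀⟩⟩ := hc
    · exact le_bot_iff.1 ((inf_le_inf (h.le_zero i h₀) (h'.le_one i h₁)).trans
        (disjoint i).le)
    · exact le_bot_iff.1 ((inf_le_inf (h.le_one i h₁) (h'.le_zero i h₀)).trans
        ((inf_comm _ _).trans (disjoint i)).le)
  · right
    push Not at hc
    refine ⟨fun i => if e i = FreeDM.var i then e' i else e i, ?_, ?_, ?_, ?_⟩
    · intro i
      split_ifs
      · exact h'.cases i
      · exact h.cases i
    · rw [map_inf, inf_eq_top_iff]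
      constructor
      · refine h.subst_eq_top_of_lift_eq _ fun i => ?_
        rcases h.cases i with hi | hi | hi
        · split_ifs with hv
          · rw [hv, FreeDM.lift_var, if_pos hv]
          · rw [hi, map_bot]
        · split_ifs with hv
          · rw [hv, FreeDM.lift_var, if_pos hv]
          · rw [hi, map_top]
        · rw [hi, FreeDM.lift_var, if_pos rfl, if_pos hi]
      · refine h'.subst_eq_top_of_lift_eq _ fun i => ?_
        rcases h'.cases i with hi | hi | hi
        · have : (if e i = FreeDM.var i then e' i else e i) = ⊥ := by
            split_ifs with hv
            · exact hi
            · rcases h.cases i with hi' | hi' | hi'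
              · exact hi'
              · exact ((hc i).2 hi' hi).elim
              · exact (hv hi').elim
          rw [this, hi, map_bot]
        · have : (if e i = FreeDM.var i then e' i else e i) = ⊤ := by
            split_ifs with hv
            · exact hi
            · rcases h.cases i with hi' | hi' | hi'
              · exact ((hc i).1 hi' hi).elim
              · exact hi'
              · exact (hv hi').elim
          rw [this, hi, map_top]
        · rw [hi, FreeDM.lift_var]
          simp only [hi]
    · intro i
      split_ifs
      · exact fun hi => inf_le_right.trans (h'.le_zero i hi)
      · exact fun hi => inf_le_left.trans (h.le_zero i hi)
    · intro i
      split_ifs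
      · exact fun hi => inf_le_right.trans (h'.le_one i hi)
      · exact fun hi => inf_le_left.trans (h.le_one i hi)

theorem top : IsCell (⊤ : Face n) FreeDM.var where
  cases _ := .inr (.inr rfl)
  subst_self := map_top _
  le_zero i h := (var_ne_bot i h).elim
  le_one i h := (var_ne_top i h).elim

theorem eqZero (i : Fin n) :
    IsCell (Face.mk (FaceTerm.eqZero i)) (Function.update FreeDM.var i ⊥) where
  cases j := by
    by_cases h : j = i
    · subst h; simp
    · simp [h]
  subst_self := by simp
  le_zero j hj := by
    by_cases h : j = i
    · subst h; exact le_rfl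
    · rw [Function.update_of_ne h] at hj; exact (var_ne_bot j hj).elim
  le_one j hj := by
    by_cases h : j = i
    · subst h; rw [Function.update_self] at hj; exact (FreeDM.bot_ne_top hj).elim
    · rw [Function.update_of_ne h] at hj; exact (var_ne_top j hj).elim

theorem eqOne (i : Fin n) :
    IsCell (Face.mk (FaceTerm.eqOne i)) (Function.update FreeDM.var i ⊤) where
  cases j := by
    by_cases h : j = i
    · subst h; simp
    · simp [h]
  subst_self := by simp
  le_zero j hj := by
    by_cases h : j = i
    · subst h; rw [Function.update_self] at hj; exact (FreeDM.bot_ne_top hj.symm).elim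
    · rw [Function.update_of_ne h] at hj; exact (var_ne_bot j hj).elim
  le_one j hj := by
    by_cases h : j = i
    · subst h; exact le_rfl
    · rw [Function.update_of_ne h] at hj; exact (var_ne_top j hj).elim

end IsCell

/-- Finite joins of cells. -/
inductive IsJoinOfCells : Face n → Prop
  | bot : IsJoinOfCells ⊥
  | cell {α : Face n} {e : Fin n → FreeDM n} : IsCell α e → IsJoinOfCells α
  | sup {α β : Face n} : IsJoinOfCells α → IsJoinOfCells β → IsJoinOfCells (α ⊔ β)

theorem IsJoinOfCells.inf {α β : Face n} (hα : IsJoinOfCells α) (hβ : IsJoinOfCells β) :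
    IsJoinOfCells (α ⊓ β) := by
  induction hα with
  | bot => rw [bot_inf_eq]; exact .bot
  | sup _ _ ih ih' => rw [inf_sup_right]; exact .sup ih ih'
  | cell h =>
    induction hβ with
    | bot => rw [inf_bot_eq]; exact .bot
    | sup _ _ ih ih' => rw [inf_sup_left]; exact .sup ih ih'
    | cell h' =>
      rcases h.inf h' with h₀ | ⟨_, h₁⟩
      · rw [h₀]; exact .bot
      · exact .cell h₁

/-- Disjunctive normal form: every face is a finite join of cells. -/
theorem isJoinOfCells (φ : Face n) : IsJoinOfCells φ := by
  induction φ using induction_on with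
  | eqZero i => exact .cell (.eqZero i)
  | eqOne i => exact .cell (.eqOne i)
  | bot => exact .bot
  | top => exact .cell .top
  | inf _ _ ih ih' => exact ih.inf ih'
  | sup _ _ ih ih' => exact ih.sup ih'

/-- The order on faces is inclusion of the sieves of maps into them. -/
theorem le_of_forall_subst {φ ψ : Face n}
    (h : ∀ f : Fin n → FreeDM n, subst f φ = ⊤ → subst f ψ = ⊤) : φ ≤ ψ := by
  induction isJoinOfCells φ with
  | bot => exact bot_le
  | @cell α e hα =>
    have := hα.inf_subst_le ψ
    rwa [h e hα.subst_self, inf_top_eq] at this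
  | sup _ _ ih ih' =>
    refine sup_le (ih fun f hf => h f ?_) (ih' fun f hf => h f ?_)
    · rw [map_sup, hf, top_sup_eq]
    · rw [map_sup, hf, sup_top_eq]

theorem ext_subst {φ ψ : Face n}
    (h : ∀ f : Fin n → FreeDM n, subst f φ = ⊤ ↔ subst f ψ = ⊤) : φ = ψ :=
  le_antisymm (le_of_forall_subst fun f => (h f).1) (le_of_forall_subst fun f => (h f).2)

/-- Universal quantification of a face over the dimension `0`: in a disjunctive normal form, the
cells which mention this dimension are dropped. -/
def forallZero : BoundedLatticeHom (Face (n + 1)) (Face n) :=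
  lift (Fin.cons ⟨⊥, ⊥, bot_inf_eq _⟩ fun i => ofDM (FreeDM.var i))

theorem generic_subst_succ (φ : Face n) :
    generic (subst (fun j => FreeDM.var j.succ) φ) = generic φ :=
  hom_ext (generic.comp (subst fun j => FreeDM.var j.succ)) generic
    (fun _ => rfl) (fun _ => rfl) φ

theorem subst_forallZero (f : Fin n → FreeDM m) (φ : Face (n + 1)) :
    subst f (forallZero φ) = ⊤ ↔ subst (FreeDM.underCons f) φ = ⊤ := by
  rw [← generic_iff, ← generic_iff]
  refine iff_of_eq (hom_ext ((generic.comp (subst f)).comp forallZero)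
    (generic.comp (subst (FreeDM.underCons f))) (fun i => ?_) (fun i => ?_) φ)
  · induction i using Fin.cases with
    | zero =>
      change generic (subst f ⊥) = generic (mk (n := m + 1) (.eqZero 0))
      rw [map_bot, map_bot]; rfl
    | succ i =>
      change generic (eqZero (f i)) =
        generic (Face.eqZero (FreeDM.lift (fun j => FreeDM.var j.succ) (f i)))
      rw [eqZero_lift, generic_subst_succ]
  · induction i using Fin.cases with
    | zero =>
      change generic (subst f ⊥) = generic (mk (n := m + 1) (.eqOne 0))
      rw [map_bot, map_bot]; rfl
    | succ i =>
      change generic (eqOne (f i)) =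
        generic (Face.eqOne (FreeDM.lift (fun j => FreeDM.var j.succ) (f i)))
      rw [eqOne_lift, generic_subst_succ]

end Face

/-! ### Subobjects of presheaves -/

section Subobjects

universe v u

variable {K : Type u} [Category.{v} K] {X Y : K ⥤ Type w}

theorem hom_ext_elements {f g : X ⟶ Y} (h : ∀ c (x : X.obj c), f.app c x = g.app c x) :
    f = g := by
  ext c x
  exact h c x

theorem map_map_eq_of_comp_eq (X : K ⥤ Type w) {a b b' c : K} {f : a ⟶ b} {g : b ⟶ c}
    {f' : a ⟶ b'} {g' : b' ⟶ c} (e : f ≫ g = f' ≫ g') (x : X.obj a) :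
    X.map g (X.map f x) = X.map g' (X.map f' x) := by
  rw [← Functor.map_comp_apply, ← Functor.map_comp_apply, e]

theorem map_map_eq_self (X : K ⥤ Type w) {a b : K} {f : a ⟶ b} {g : b ⟶ a} (e : f ≫ g = 𝟙 a)
    (x : X.obj a) : X.map g (X.map f x) = x := by
  rw [← Functor.map_comp_apply, e, Functor.map_id_apply]

/-- The subpresheaf of elements which belong to a subobject. -/
noncomputable def elts (φ : Subobject X) : Subfunctor X :=
  (Subfunctor.orderIsoSubobject X).symm φ

theorem elts_le_iff {φ ψ : Subobject X} : elts φ ≤ elts ψ ↔ φ ≤ ψ :=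
  (Subfunctor.orderIsoSubobject X).symm.le_iff_le

theorem elts_injective : Function.Injective (elts (X := X)) :=
  (Subfunctor.orderIsoSubobject X).symm.injective

theorem elts_surjective : Function.Surjective (elts (X := X)) :=
  (Subfunctor.orderIsoSubobject X).symm.surjective

theorem elts_inf (φ ψ : Subobject X) : elts (φ ⊓ ψ) = elts φ ⊓ elts ψ := by
  refine le_antisymm (le_inf (elts_le_iff.2 inf_le_left) (elts_le_iff.2 inf_le_right)) ?_
  obtain ⟨θ, hθ⟩ := elts_surjective (elts φ ⊓ elts ψ)
  rw [← hθ, elts_le_iff]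
  exact le_inf (elts_le_iff.1 (hθ.trans_le inf_le_left)) (elts_le_iff.1 (hθ.trans_le inf_le_right))

theorem isLUB_pair_iff {φ ψ χ : Subobject X} :
    IsLUB {φ, ψ} χ ↔ ∀ c, (elts χ).obj c = (elts φ).obj c ∪ (elts ψ).obj c := by
  obtain ⟨θ, hθ⟩ := elts_surjective (elts φ ⊔ elts ψ)
  have hlub : IsLUB {φ, ψ} θ := by
    constructor
    · rintro _ (rfl | rfl)
      · exact elts_le_iff.1 (hθ ▸ le_sup_left)
      · exact elts_le_iff.1 (hθ ▸ le_sup_right)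
    · intro ρ hρ
      rw [← elts_le_iff, hθ]
      exact sup_le (elts_le_iff.2 (hρ (.inl rfl))) (elts_le_iff.2 (hρ (.inr rfl)))
  constructor
  · intro h c
    rw [h.unique hlub, hθ]
    rfl
  · intro h
    have : χ = θ := elts_injective (by rw [hθ]; exact Subfunctor.ext (funext h))
    rwa [this]

theorem isBot_iff {φ : Subobject X} : IsBot φ ↔ ∀ c (x : X.obj c), x ∉ (elts φ).obj c := by
  constructor
  · intro h c x hx
    obtain ⟨θ, hθ⟩ := elts_surjective (⊥ : Subfunctor X)
    have := elts_le_iff.2 (h θ) c hx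
    rw [hθ] at this
    exact this
  · intro h ψ
    rw [← elts_le_iff]
    exact fun c x hx => (h c x hx).elim

theorem mem_elts_mk {Z : K ⥤ Type w} (m : Z ⟶ X) [Mono m] {c : K} (x : X.obj c) :
    x ∈ (elts (Subobject.mk m)).obj c ↔ ∃ z, m.app c z = x := by
  change (∃ z, _) ↔ _
  constructor
  · rintro ⟨z, rfl⟩
    refine ⟨(Subobject.underlyingIso m).hom.app c z, ?_⟩
    rw [← ConcreteCategory.comp_apply, ← NatTrans.comp_app, Subobject.underlyingIso_hom_comp_eq_mk]
  · rintro ⟨z, rfl⟩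
    refine ⟨(Subobject.underlyingIso m).inv.app c z, ?_⟩
    rw [← ConcreteCategory.comp_apply, ← NatTrans.comp_app, Subobject.underlyingIso_arrow]

theorem mem_elts {φ : Subobject X} {c : K} (x : X.obj c) :
    x ∈ (elts φ).obj c ↔ ∃ z, φ.arrow.app c z = x := Iff.rfl

theorem app_injective_of_mono {X Y : K ⥤ Type w} (m : X ⟶ Y) [Mono m] (c : K) :
    Function.Injective (m.app c) :=
  (mono_iff_injective (m.app c)).1 inferInstance

/-- The elements of a pullback square of presheaves are the compatible pairs. -/
theorem exists_of_isPullback {P Q R S : K ⥤ Type w} {a : P ⟶ Q} {b : P ⟶ R} {f : Q ⟶ S}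
    {g : R ⟶ S} (h : IsPullback a b f g) {c : K} (x : Q.obj c) (y : R.obj c)
    (hxy : f.app c x = g.app c y) : ∃ z, a.app c z = x ∧ b.app c z = y :=
  ((Types.isPullback_iff _ _ _ _).1 (h.map ((evaluation K (Type w)).obj c))).2.2 x y hxy

theorem ext_of_isPullback {P Q R S : K ⥤ Type w} {a : P ⟶ Q} {b : P ⟶ R} {f : Q ⟶ S}
    {g : R ⟶ S} (h : IsPullback a b f g) {c : K} {x y : P.obj c}
    (h₁ : a.app c x = a.app c y) (h₂ : b.app c x = b.app c y) : x = y :=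
  ((Types.isPullback_iff _ _ _ _).1 (h.map ((evaluation K (Type w)).obj c))).2.1 x y ⟨h₁, h₂⟩

theorem w_app_of_isPullback {P Q R S : K ⥤ Type w} {a : P ⟶ Q} {b : P ⟶ R} {f : Q ⟶ S}
    {g : R ⟶ S} (h : IsPullback a b f g) {c : K} (x : P.obj c) :
    f.app c (a.app c x) = g.app c (b.app c x) :=
  congrArg (fun k => k.app c x) h.w

theorem isPullback_of_forall_elements {P Q R S : K ⥤ Type w} {a : P ⟶ Q} {b : P ⟶ R}
    {f : Q ⟶ S} {g : R ⟶ S} (w : a ≫ f = b ≫ g)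
    (ext : ∀ c (x y : P.obj c), a.app c x = a.app c y → b.app c x = b.app c y → x = y)
    (ex : ∀ c (x : Q.obj c) (y : R.obj c), f.app c x = g.app c y →
      ∃ z, a.app c z = x ∧ b.app c z = y) : IsPullback a b f g :=
  IsPullback.of_forall_isPullback_app fun c => (Types.isPullback_iff _ _ _ _).2
    ⟨congrArg (fun k => k.app c) w, fun x y h => ext c x y h.1 h.2, fun x y h => ex c x y h⟩

theorem mem_elts_pullback (f : Y ⟶ X) (φ : Subobject X) {c : K} (y : Y.obj c) :
    y ∈ (elts ((Subobject.pullback f).obj φ)).obj c ↔ f.app c y ∈ (elts φ).obj c := by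
  have h := Subobject.isPullback f φ
  rw [mem_elts, mem_elts]
  constructor
  · rintro ⟨z, rfl⟩
    exact ⟨_, w_app_of_isPullback h z⟩
  · rintro ⟨z, hz⟩
    obtain ⟨z', -, h'⟩ := exists_of_isPullback h z y hz
    exact ⟨z', h'⟩

theorem mem_elts_mk_equalizer (f g : X ⟶ Y) {c : K} (x : X.obj c) :
    x ∈ (elts (Subobject.mk (equalizer.ι f g))).obj c ↔ f.app c x = g.app c x := by
  rw [mem_elts_mk]
  constructor
  · rintro ⟨z, rfl⟩
    exact congrArg (fun k => k.app c z) (equalizer.condition f g)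
  · intro h
    let S : Subfunctor X :=
      { obj c := {x | f.app c x = g.app c x}
        map {c d} k x hx := by
          change f.app d _ = g.app d _
          rw [NatTrans.naturality_apply, NatTrans.naturality_apply]
          exact congrArg _ hx }
    have hS : S.ι ≫ f = S.ι ≫ g := by
      ext c x
      exact x.2
    exact ⟨(equalizer.lift S.ι hS).app c ⟨x, h⟩,
      congrArg (fun k => k.app c ⟨x, h⟩) (equalizer.lift_ι S.ι hS)⟩

/-- A family of sets closed under restriction is the family of elements of a subobject. -/
theorem exists_mem_elts_iff (D : ∀ c, Set (X.obj c))
    (hD : ∀ {c d : K} (f : c ⟶ d) (x : X.obj c), x ∈ D c → X.map f x ∈ D d) :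
    ∃ φ : Subobject X, ∀ c, (elts φ).obj c = D c := by
  obtain ⟨φ, hφ⟩ := elts_surjective (X := X) ⟨D, fun f x hx => hD f x hx⟩
  exact ⟨φ, fun c => by rw [hφ]⟩

end Subobjects

/-! ### Cofibrant subobjects as classified by faces -/

section Cof

universe v u

variable {E : Type u} [Category.{v} E] [CartesianMonoidalCategory E] [HasFiniteLimits E]
  [HasSubobjectClassifier E] (S : CubicalStructure E)

theorem χ_eq_χ_iff {E : Type u} [Category.{v} E] [HasPullbacks E] [HasSubobjectClassifier E]
    {X A B : E} (f : A ⟶ X) (g : B ⟶ X) [Mono f] [Mono g] :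
    HasSubobjectClassifier.χ f = HasSubobjectClassifier.χ g ↔
      Subobject.mk f = Subobject.mk g := by
  let c := (HasSubobjectClassifier.exists_classifier (C := E)).some
  constructor
  · intro h
    rw [← c.pullback_χ_obj_mk_truth f, ← c.pullback_χ_obj_mk_truth g]
    exact congrArg (fun k => (Subobject.pullback k).obj c.truth_as_subobject) h
  · intro h
    have := c.representableBy.homEquiv.injective (a₁ := c.χ f) (a₂ := c.χ g) (by
      change (Subobject.pullback (c.χ f)).obj c.truth_as_subobject =
        (Subobject.pullback (c.χ g)).obj c.truth_as_subobject
      rw [c.pullback_χ_obj_mk_truth f, c.pullback_χ_obj_mk_truth g, h])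
    exact this

theorem comp_faceEmb {X : E} (a : X ⟶ S.face.X) :
    a ≫ S.faceEmb = HasSubobjectClassifier.χ (S.faceSub a).arrow := by
  have := mono_of_unit S.face.top
  let c := (HasSubobjectClassifier.exists_classifier (C := E)).some
  have h₁ : IsPullback (S.faceSub a).arrow
      (Subobject.pullbackπ a (Subobject.mk S.face.top)) a (Subobject.mk S.face.top).arrow :=
    (Subobject.isPullback a (Subobject.mk S.face.top)).flip
  have h₂ : c.χ (Subobject.mk S.face.top).arrow = S.faceEmb :=
    (χ_eq_χ_iff _ _).2 (Subobject.mk_arrow _)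
  have := c.uniq _ (h₁.paste_vert (c.isPullback (Subobject.mk S.face.top).arrow))
  rw [← h₂]
  exact this

theorem isCof_iff {X : E} (φ : Subobject X) : S.IsCof φ ↔ ∃ a, S.faceSub a = φ := by
  refine exists_congr fun a => ?_
  rw [comp_faceEmb, χ_eq_χ_iff, Subobject.mk_arrow, Subobject.mk_arrow]

theorem mono_faceEmb_of_injective
    (h : ∀ {X : E} (a b : X ⟶ S.face.X), S.faceSub a = S.faceSub b → a = b) : Mono S.faceEmb where
  right_cancellation a b hab := h a b (by
    rwa [comp_faceEmb, comp_faceEmb, χ_eq_χ_iff, Subobject.mk_arrow, Subobject.mk_arrow] at hab)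

end Cof

/-! ### The lattice of faces as a sublattice of the subobject classifier -/

section Axioms

variable {C : Type w} [SmallCategory C] {X : CubicalPSh C}

theorem mem_elts_faceSub (a : X ⟶ (presheafFace C).X) {c : (C × Cube)ᵒᵖ} (x : X.obj c) :
    x ∈ (elts ((presheafCubical C).faceSub a)).obj c ↔ (a.app c x).down = ⊤ := by
  have := mono_of_unit (presheafCubical C).face.top
  refine (mem_elts_pullback _ _ _).trans ((mem_elts_mk _ _).trans ?_)
  constructor
  · rintro ⟨_, h⟩
    exact (congrArg ULift.down h).symm
  · intro h
    exact ⟨PUnit.unit, congrArg ULift.up h.symm⟩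

theorem face_app_map (a : X ⟶ (presheafFace C).X) {c d : (C × Cube)ᵒᵖ} (f : c ⟶ d) (x : X.obj c) :
    (a.app d (X.map f x)).down = Face.subst f.unop.2 (a.app c x).down :=
  congrArg ULift.down (NatTrans.naturality_apply a f x)

theorem interval_app_map (a : X ⟶ (presheafInterval C).X) {c d : (C × Cube)ᵒᵖ} (f : c ⟶ d)
    (x : X.obj c) : (a.app d (X.map f x)).down = FreeDM.lift f.unop.2 (a.app c x).down :=
  congrArg ULift.down (NatTrans.naturality_apply a f x)

/-- The map of `C × Cube` given by the identity in `C` and a map of cubes. -/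
abbrev cubeHom (c : (C × Cube)ᵒᵖ) {n : ℕ} (f : Fin c.unop.2.dim → FreeDM n) :
    c ⟶ Opposite.op (c.unop.1, ⟨n⟩) :=
  Quiver.Hom.op (X := (c.unop.1, (⟨n⟩ : Cube))) (Y := c.unop) (𝟙 c.unop.1, f)

theorem faceSub_injective (a b : X ⟶ (presheafFace C).X)
    (h : (presheafCubical C).faceSub a = (presheafCubical C).faceSub b) : a = b := by
  ext c x
  refine congrArg ULift.up (Face.ext_subst fun f => ?_)
  have key (a : X ⟶ (presheafFace C).X) :
      X.map (cubeHom c f) x ∈ (elts ((presheafCubical C).faceSub a)).obj _ ↔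
        Face.subst f (a.app c x).down = ⊤ :=
    (mem_elts_faceSub a _).trans
      (iff_of_eq (congrArg (· = ⊤) (face_app_map a (cubeHom c f) x)))
  exact (key a).symm.trans ((iff_of_eq (by rw [h])).trans (key b))

/-- A subobject is cofibrant iff the sieve on which an element of the ambient presheaf belongs to
it is always the sieve of a face. The face is unique, so that no naturality condition
arises. -/
theorem isCof_iff_exists_face (φ : Subobject X) :
    (presheafCubical C).IsCof φ ↔ ∀ (c : (C × Cube)ᵒᵖ) (x : X.obj c),
      ∃ ψ : Face c.unop.2.dim, ∀ (d : (C × Cube)ᵒᵖ) (f : c ⟶ d),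
        X.map f x ∈ (elts φ).obj d ↔ Face.subst f.unop.2 ψ = ⊤ := by
  rw [isCof_iff]
  constructor
  · rintro ⟨a, rfl⟩ c x
    refine ⟨(a.app c x).down, fun d f => ?_⟩
    exact (mem_elts_faceSub a _).trans (iff_of_eq (congrArg (· = ⊤) (face_app_map a f x)))
  · intro h
    choose ψ hψ using h
    refine ⟨{ app c := ↾fun x => ⟨ψ c x⟩, naturality c d f := ?_ }, ?_⟩
    · ext x
      refine congrArg ULift.up (Face.ext_subst fun g => ?_)
      have h₁ := hψ d (X.map f x) _ (cubeHom d g)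
      have h₂ := hψ c x _ (f ≫ cubeHom d g)
      rw [Functor.map_comp_apply] at h₂
      refine h₁.symm.trans (h₂.trans ?_)
      exact iff_of_eq (congrArg (· = ⊤) (Face.subst_subst f.unop.2 g (ψ c x)).symm)
    · refine elts_injective (Subfunctor.ext (funext fun c => Set.ext fun x => ?_))
      have := hψ c x c (𝟙 c)
      rw [Functor.map_id_apply] at this
      refine (mem_elts_faceSub _ x).trans (Iff.trans ?_ this.symm)
      exact iff_of_eq (congrArg (· = ⊤) (Face.subst_var (ψ c x)).symm)

theorem isBot_faceSub_bot (Γ : CubicalPSh C) :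
    IsBot ((presheafCubical C).faceSub (toUnit Γ ≫ (presheafFace C).bot)) :=
  isBot_iff.2 fun _ x hx => Face.bot_ne_top ((mem_elts_faceSub _ x).1 hx)

theorem faceSub_inf {Γ : CubicalPSh C} (φ ψ : Γ ⟶ (presheafFace C).X) :
    (presheafCubical C).faceSub (lift φ ψ ≫ (presheafFace C).inf) =
      (presheafCubical C).faceSub φ ⊓ (presheafCubical C).faceSub ψ := by
  refine elts_injective (Subfunctor.ext (funext fun c => Set.ext fun x => ?_))
  rw [elts_inf, Subfunctor.min_obj, Set.mem_inter_iff, mem_elts_faceSub φ, mem_elts_faceSub ψ]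
  exact (mem_elts_faceSub _ x).trans inf_eq_top_iff

theorem isLUB_faceSub_sup {Γ : CubicalPSh C} (φ ψ : Γ ⟶ (presheafFace C).X) :
    IsLUB {(presheafCubical C).faceSub φ, (presheafCubical C).faceSub ψ}
      ((presheafCubical C).faceSub (lift φ ψ ≫ (presheafFace C).sup)) := by
  refine isLUB_pair_iff.2 fun c => Set.ext fun x => ?_
  rw [Set.mem_union, mem_elts_faceSub φ, mem_elts_faceSub ψ]
  exact (mem_elts_faceSub _ x).trans (Face.sup_eq_top_iff _ _)

theorem faceSub_eqZero {Γ : CubicalPSh C} (r : Γ ⟶ (presheafInterval C).X) :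
    (presheafCubical C).faceSub (r ≫ (presheafCubical C).eqZero) =
      Subobject.mk (equalizer.ι r (toUnit Γ ≫ (presheafInterval C).bot)) := by
  refine elts_injective (Subfunctor.ext (funext fun c => Set.ext fun x => ?_))
  rw [mem_elts_mk_equalizer]
  refine (mem_elts_faceSub _ x).trans ((Face.eqZero_eq_top_iff (r.app c x).down).trans ?_)
  exact ⟨fun h => congrArg ULift.up h, fun h => congrArg ULift.down h⟩

theorem isCof_eq_one {Γ : CubicalPSh C} (r : Γ ⟶ (presheafInterval C).X) :
    (presheafCubical C).IsCof
      (Subobject.mk (equalizer.ι r (toUnit Γ ≫ (presheafInterval C).top))) := by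
  refine (isCof_iff_exists_face _).2 fun c x => ⟨Face.eqOne (r.app c x).down, fun d f => ?_⟩
  rw [mem_elts_mk_equalizer, ← Face.eqOne_lift, Face.eqOne_eq_top_iff, ← interval_app_map]
  exact ⟨fun h => congrArg ULift.down h, fun h => congrArg ULift.up h⟩

theorem isCof_sup {φ ψ χ : Subobject X} (hφ : (presheafCubical C).IsCof φ)
    (hψ : (presheafCubical C).IsCof ψ) (h : IsLUB {φ, ψ} χ) : (presheafCubical C).IsCof χ := by
  rw [isCof_iff_exists_face] at *
  intro c x
  obtain ⟨α, hα⟩ := hφ c x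
  obtain ⟨β, hβ⟩ := hψ c x
  refine ⟨α ⊔ β, fun d f => ?_⟩
  rw [isLUB_pair_iff.1 h, Set.mem_union, hα, hβ, map_sup, Face.sup_eq_top_iff]

/-- The sieve of maps which land in a face `α` and satisfy `P` is given by a face as soon as this
holds after restriction along each map landing in `α`. For a cell the restriction to its
retraction suffices, and the general case follows by disjunctive normal form. -/
theorem exists_face_inf {c : (C × Cube)ᵒᵖ} (α : Face c.unop.2.dim)
    (P : ∀ d : (C × Cube)ᵒᵖ, (c ⟶ d) → Prop)
    (h : ∀ (n : ℕ) (e : Fin c.unop.2.dim → FreeDM n), Face.subst e α = ⊤ →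
      ∃ ψ : Face n, ∀ (d : (C × Cube)ᵒᵖ) (f : Opposite.op (c.unop.1, ⟨n⟩) ⟶ d),
        P d (cubeHom c e ≫ f) ↔ Face.subst f.unop.2 ψ = ⊤) :
    ∃ ψ : Face c.unop.2.dim, ∀ (d : (C × Cube)ᵒᵖ) (f : c ⟶ d),
      (Face.subst f.unop.2 α = ⊤ ∧ P d f) ↔ Face.subst f.unop.2 ψ = ⊤ := by
  induction Face.isJoinOfCells α with
  | bot =>
    refine ⟨⊥, fun d f => ?_⟩
    rw [map_bot]
    exact ⟨fun h => h.1, fun h => (Face.bot_ne_top h).elim⟩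
  | @cell α e hα =>
    obtain ⟨ψ, hψ⟩ := h _ e hα.subst_self
    refine ⟨α ⊓ ψ, fun d f => ?_⟩
    rw [map_inf, inf_eq_top_iff]
    refine and_congr_right fun hf => ?_
    have h' : cubeHom c e ≫ f = f := by
      refine Quiver.Hom.unop_inj (Prod.ext (Category.comp_id _) ?_)
      exact funext fun i => hα.lift_eq f.unop.2 hf i
    have := hψ d f
    rwa [h'] at this
  | @sup α β _ _ ih ih' =>
    obtain ⟨ψ, hψ⟩ := ih fun n e he => h n e (by rw [map_sup, he, top_sup_eq])
    obtain ⟨ψ', hψ'⟩ := ih' fun n e he => h n e (by rw [map_sup, he, sup_top_eq])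
    refine ⟨ψ ⊔ ψ', fun d f => ?_⟩
    rw [map_sup, map_sup, Face.sup_eq_top_iff, Face.sup_eq_top_iff, ← hψ, ← hψ', or_and_right]

theorem isCof_inf {φ ψ : Subobject X} (hφ : (presheafCubical C).IsCof φ)
    (hψ : (presheafCubical C).IsCof ((Subobject.pullback φ.arrow).obj ψ)) :
    (presheafCubical C).IsCof (φ ⊓ ψ) := by
  rw [isCof_iff_exists_face] at *
  intro c x
  obtain ⟨α, hα⟩ := hφ c x
  obtain ⟨β, hβ⟩ := exists_face_inf α (fun d f => X.map f x ∈ (elts ψ).obj d) fun n e he => by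
    obtain ⟨z, hz⟩ := (hα _ (cubeHom c e)).2 he
    obtain ⟨β, hβ⟩ := hψ _ z
    refine ⟨β, fun d f => ?_⟩
    rw [← hβ, mem_elts_pullback, NatTrans.naturality_apply, Functor.map_comp_apply]
    exact iff_of_eq (congrArg (fun y => X.map f y ∈ (elts ψ).obj d) hz.symm)
  refine ⟨β, fun d f => ?_⟩
  rw [elts_inf, Subfunctor.min_obj, Set.mem_inter_iff, hα, hβ]

/-! ### Quantification over the interval

The product of a representable with the interval is representable by adding a dimension, so a
statement about all elements of the interval is a statement about the generic one. -/

/-- The coordinate `0` of a cube with a fresh dimension. -/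
def freshVar (c : C) (n : ℕ) :
    (presheafInterval C).X.obj (Opposite.op (c, ⟨n + 1⟩)) := ⟨FreeDM.var (n := n + 1) 0⟩

/-- The map of cubes forgetting the fresh dimension `0`. -/
def degeneracy (n : ℕ) : Fin n → FreeDM (n + 1) := fun i => FreeDM.var i.succ

/-- The weakening of an element together with the fresh coordinate. -/
def genericPair {c : (C × Cube)ᵒᵖ} (x : X.obj c) :
    (X ⊗ (presheafInterval C).X).obj (Opposite.op (c.unop.1, ⟨c.unop.2.dim + 1⟩)) :=
  (X.map (cubeHom c (degeneracy _)) x, freshVar _ _)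

/-- The map which instantiates the fresh coordinate by an element of the interval. -/
abbrev instantiate {c d : (C × Cube)ᵒᵖ} (f : c ⟶ d) (r : FreeDM d.unop.2.dim) :
    Opposite.op (c.unop.1, (⟨c.unop.2.dim + 1⟩ : Cube)) ⟶ d :=
  Quiver.Hom.op (X := d.unop) (Y := (c.unop.1, (⟨c.unop.2.dim + 1⟩ : Cube)))
    (f.unop.1, Fin.cons r f.unop.2)

theorem cubeHom_degeneracy_comp_instantiate {c d : (C × Cube)ᵒᵖ} (f : c ⟶ d)
    (r : FreeDM d.unop.2.dim) : cubeHom c (degeneracy _) ≫ instantiate f r = f :=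
  Quiver.Hom.unop_inj (Prod.ext (Category.comp_id _) (funext fun _ => rfl))

theorem map_instantiate_genericPair {c d : (C × Cube)ᵒᵖ} (f : c ⟶ d) (r : FreeDM d.unop.2.dim)
    (x : X.obj c) :
    (X ⊗ (presheafInterval C).X).map (instantiate f r) (genericPair x) =
      (X.map f x, ⟨r⟩) := by
  have h : X.map (instantiate f r) (X.map (cubeHom c (degeneracy _)) x) = X.map f x := by
    rw [← Functor.map_comp_apply, cubeHom_degeneracy_comp_instantiate]
  exact congrArg (fun y => (y, (⟨r⟩ : ULift (FreeDM d.unop.2.dim)))) h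

/-- The subobject `∀ i, φ i`: it contains the elements whose generic pair belongs to `φ`. -/
theorem exists_forall (φ : Subobject (X ⊗ (presheafInterval C).X)) :
    ∃ θ : Subobject X,
    (Subobject.pullback (fst X (presheafInterval C).X)).obj θ ≤ φ ∧
    ∀ (c : (C × Cube)ᵒᵖ) (x : X.obj c), genericPair x ∈ (elts φ).obj _ → x ∈ (elts θ).obj c := by
  obtain ⟨θ, hθ⟩ := exists_mem_elts_iff (X := X)
    (fun c => {x | ∀ (d : (C × Cube)ᵒᵖ) (f : c ⟶ d) (r : FreeDM d.unop.2.dim),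
      (show (X ⊗ (presheafInterval C).X).obj d from (X.map f x, ⟨r⟩)) ∈ (elts φ).obj d})
    (fun f x hx d g r => by
      have := hx d (f ≫ g) r
      rwa [Functor.map_comp_apply] at this)
  refine ⟨θ, ?_, fun c x hx => ?_⟩
  · rw [← elts_le_iff]
    intro c x hx
    rw [mem_elts_pullback, hθ] at hx
    have := hx c (𝟙 c) x.2.down
    rw [Functor.map_id_apply] at this
    exact this
  · rw [hθ]
    intro d f r
    have := (elts φ).map (instantiate f r) hx
    rw [Set.mem_preimage, map_instantiate_genericPair] at this
    exact this

theorem interval_connected (φ ψ : Subobject (X ⊗ (presheafInterval C).X))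
    (h : IsLUB {φ, ψ} ⊤) : ∃ θ₀ θ₁ : Subobject X, IsLUB {θ₀, θ₁} ⊤ ∧
      (Subobject.pullback (fst X (presheafInterval C).X)).obj θ₀ ≤ φ ∧
      (Subobject.pullback (fst X (presheafInterval C).X)).obj θ₁ ≤ ψ := by
  obtain ⟨θ₀, h₀, h₀'⟩ := exists_forall φ
  obtain ⟨θ₁, h₁, h₁'⟩ := exists_forall ψ
  refine ⟨θ₀, θ₁, isLUB_pair_iff.2 fun c => Set.ext fun x => ?_, h₀, h₁⟩
  have hx := isLUB_pair_iff.1 h (Opposite.op (c.unop.1, ⟨c.unop.2.dim + 1⟩))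
  have htop (Y : CubicalPSh C) (d) (y : Y.obj d) : y ∈ (elts (⊤ : Subobject Y)).obj d :=
    elts_le_iff.2 (le_top : Subobject.mk (⊤ : Subfunctor Y).ι ≤ ⊤) d
      ((mem_elts_mk _ _).2 ⟨⟨y, trivial⟩, rfl⟩)
  have hx' : genericPair x ∈ (elts φ).obj _ ∪ (elts ψ).obj _ := hx ▸ htop _ _ _
  exact ⟨fun _ => hx'.imp (h₀' c x) (h₁' c x), fun _ => htop _ _ _⟩

theorem map_underCons_genericPair {c d : (C × Cube)ᵒᵖ} (f : c ⟶ d) (x : X.obj c) :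
    (X ⊗ (presheafInterval C).X).map (Quiver.Hom.op (X := (d.unop.1, (⟨d.unop.2.dim + 1⟩ : Cube)))
      (Y := (c.unop.1, (⟨c.unop.2.dim + 1⟩ : Cube))) (f.unop.1, FreeDM.underCons f.unop.2))
      (genericPair x) = genericPair (X.map f x) := by
  have h : X.map (Quiver.Hom.op (X := (d.unop.1, (⟨d.unop.2.dim + 1⟩ : Cube)))
      (Y := (c.unop.1, (⟨c.unop.2.dim + 1⟩ : Cube))) (f.unop.1, FreeDM.underCons f.unop.2))
      (X.map (cubeHom c (degeneracy _)) x) = X.map (cubeHom d (degeneracy _)) (X.map f x) := by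
    have e : cubeHom c (degeneracy _) ≫ (Quiver.Hom.op (X := (d.unop.1,
        (⟨d.unop.2.dim + 1⟩ : Cube))) (Y := (c.unop.1, (⟨c.unop.2.dim + 1⟩ : Cube)))
        (f.unop.1, FreeDM.underCons f.unop.2)) = f ≫ cubeHom d (degeneracy _) :=
      Quiver.Hom.unop_inj
        (Prod.ext ((Category.comp_id _).trans (Category.id_comp _).symm) (funext fun i => rfl))
    rw [← Functor.map_comp_apply, ← Functor.map_comp_apply, e]
  exact congrArg (fun y => (y, freshVar _ _)) h

/-- `∀ i, φ i` holds of `x` iff `φ` holds of the generic pair of `x`. -/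
theorem mem_elts_forall_iff {φ : Subobject (X ⊗ (presheafInterval C).X)} {ψ : Subobject X}
    (h : IsGreatest {θ | (Subobject.pullback (fst X (presheafInterval C).X)).obj θ ≤ φ} ψ)
    {c : (C × Cube)ᵒᵖ} (x : X.obj c) :
    x ∈ (elts ψ).obj c ↔ genericPair x ∈ (elts φ).obj _ := by
  constructor
  · intro hx
    refine elts_le_iff.2 h.1 _ ((mem_elts_pullback _ _ _).2 ?_)
    exact (elts ψ).map (cubeHom c (degeneracy _)) hx
  · intro hx
    obtain ⟨θ, hθ, hθ'⟩ := exists_forall φ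
    exact elts_le_iff.2 (h.2 hθ) c (hθ' c x hx)

theorem isCof_forall {φ : Subobject (X ⊗ (presheafInterval C).X)} {ψ : Subobject X}
    (hφ : (presheafCubical C).IsCof φ)
    (h : IsGreatest {θ | (Subobject.pullback (fst X (presheafInterval C).X)).obj θ ≤ φ} ψ) :
    (presheafCubical C).IsCof ψ := by
  rw [isCof_iff_exists_face] at *
  intro c x
  obtain ⟨α, hα⟩ := hφ _ (genericPair x)
  refine ⟨Face.forallZero α, fun d f => ?_⟩
  rw [Face.subst_forallZero]
  rw [mem_elts_forall_iff h, ← map_underCons_genericPair]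
  exact hα _ _

theorem isInitial_of_bot_eq_top (Γ : CubicalPSh C)
    (h : toUnit Γ ≫ (presheafInterval C).bot = toUnit Γ ≫ (presheafInterval C).top) :
    Nonempty (IsInitial Γ) := by
  have he (c) (x : Γ.obj c) : False :=
    FreeDM.bot_ne_top (congrArg (fun k => (k.app c x).down) h)
  exact ⟨IsInitial.ofUniqueHom
    (fun Y => { app c := ↾fun x => (he c x).elim, naturality c d f := by ext x; exact (he c x).elim })
    (fun Y m => by ext c x; exact (he c x).elim)⟩

end Axioms

/-! ### Tininess of the interval -/

section Tiny

variable (C : Type w) [SmallCategory C]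

/-- The endofunctor of the category of cubes which adds a dimension. -/
def addDim : Cube ⥤ Cube where
  obj X := ⟨X.dim + 1⟩
  map f := FreeDM.underCons f
  map_id X := FreeDM.underCons_var X.dim
  map_comp f g := FreeDM.underCons_lift g f

/-- Restriction along adding a dimension: the path functor of cubical sets. -/
def pathFunctor : CubicalPSh C ⥤ CubicalPSh C :=
  (Functor.whiskeringLeft _ _ _).obj ((𝟭 C).prod addDim).op

variable {C}

theorem instantiate_naturality {c d : (C × Cube)ᵒᵖ} (f : c ⟶ d) (r : FreeDM c.unop.2.dim) :
    instantiate (𝟙 c) r ≫ f =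
      ((𝟭 C).prod addDim).op.map f ≫ instantiate (𝟙 d) (FreeDM.lift f.unop.2 r) := by
  refine Quiver.Hom.unop_inj (Prod.ext ((Category.comp_id _).trans (Category.id_comp _).symm)
    (funext fun i => ?_))
  induction i using Fin.cases with
  | zero => rfl
  | succ i =>
    exact (FreeDM.lift_var_self (f.unop.2 i)).symm.trans (FreeDM.lift_lift
      (fun j => FreeDM.var j.succ)
      (Fin.cons (FreeDM.lift f.unop.2 r) FreeDM.var : Fin (d.unop.2.dim + 1) → _)
      (f.unop.2 i)).symm

theorem cubeHom_degeneracy_naturality {c d : (C × Cube)ᵒᵖ} (f : c ⟶ d) :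
    f ≫ cubeHom d (degeneracy _) =
      cubeHom c (degeneracy _) ≫ ((𝟭 C).prod addDim).op.map f :=
  Quiver.Hom.unop_inj (Prod.ext ((Category.id_comp _).trans (Category.comp_id _).symm)
    (funext fun _ => rfl))

/-- An element of `Y` in the cube with a fresh dimension is the same as a family of elements
of `Y` indexed by the interval. -/
def tensorLeftAdjPath : tensorLeft (presheafInterval C).X ⊣ pathFunctor C :=
  Adjunction.mkOfUnitCounit
    { unit :=
        { app X :=
            { app c := ↾fun x => (freshVar c.unop.1 c.unop.2.dim,
                X.map (cubeHom c (degeneracy _)) x)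
              naturality c d f := by
                ext x
                exact congrArg (fun y => (freshVar d.unop.1 d.unop.2.dim, y))
                  (map_map_eq_of_comp_eq X (cubeHom_degeneracy_naturality f) x) }
          naturality X Y f := by
            ext c x
            exact congrArg (fun y => (freshVar c.unop.1 c.unop.2.dim, y))
              (NatTrans.naturality_apply f (cubeHom c (degeneracy _)) x).symm }
      counit :=
        { app Y :=
            { app c := ↾fun p => Y.map (instantiate (𝟙 c) p.1.down) p.2
              naturality c d f := by
                ext p
                exact (map_map_eq_of_comp_eq Y (instantiate_naturality f p.1.down) p.2).symm }
          naturality X Y f := by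
            ext c p
            exact (NatTrans.naturality_apply f (instantiate (𝟙 c) p.1.down) p.2).symm }
      left_triangle := by
        ext X c p
        exact congrArg (fun y => (p.1, y))
          (map_map_eq_self X (cubeHom_degeneracy_comp_instantiate (𝟙 c) p.1.down) p.2)
      right_triangle := by
        ext Y c y
        have e : ((𝟭 C).prod addDim).op.map (cubeHom c (degeneracy _)) ≫
            instantiate (𝟙 (Opposite.op (c.unop.1, (⟨c.unop.2.dim + 1⟩ : Cube))))
              (FreeDM.var (n := c.unop.2.dim + 1) 0) = 𝟙 _ := by
          refine Quiver.Hom.unop_inj (Prod.ext (Category.comp_id _) (funext fun i => ?_))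
          induction i using Fin.cases with
          | zero => rfl
          | succ i => rfl
        exact map_map_eq_self Y e y }

theorem interval_tiny : (ihom (presheafInterval C).X).IsLeftAdjoint := by
  have : (pathFunctor C).IsLeftAdjoint :=
    ⟨_, ⟨((𝟭 C).prod addDim).op.ranAdjunction (Type w)⟩⟩
  exact Functor.isLeftAdjoint_of_iso
    ((ihom.adjunction (presheafInterval C).X).rightAdjointUniq tensorLeftAdjPath).symm

end Tiny

/-! ### Closure properties of inaccessible cardinals -/

section Cardinals

open Cardinal

theorem mk_sigma_lt {κ : Cardinal.{w}} (hκ : κ.IsRegular) {ι : Type w} {A : ι → Type w}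
    (hι : #ι < κ) (hA : ∀ i, #(A i) < κ) : #(Σ i, A i) < κ := by
  rw [mk_sigma]
  exact sum_lt_of_isRegular hκ hι hA

theorem mk_pi_lt {κ : Cardinal.{w}} (hκ : κ.IsInaccessible) {ι : Type w} {A : ι → Type w}
    (hι : #ι < κ) (hA : ∀ i, #(A i) < κ) : #(∀ i, A i) < κ := by
  -- A dependent function is determined by its graph.
  refine (mk_le_of_injective (β := Set (Σ i, A i))
    (f := fun f => {p | f p.1 = p.2}) fun f g h => ?_).trans_lt ?_
  · funext i
    have : (⟨i, f i⟩ : Σ i, A i) ∈ {p : Σ i, A i | f p.1 = p.2} := rfl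
    rw [show {p : Σ i, A i | f p.1 = p.2} = {p | g p.1 = p.2} from h] at this
    exact this.symm
  · rw [mk_set]
    exact hκ.isStrongLimit.isStrongPrelimit (mk_sigma_lt hκ.isRegular hι hA)

end Cardinals

/-! ### The universe of small families of presheaves -/

section Universe

open Cardinal Opposite

variable {K : Type w} [SmallCategory K]

/-- The presheaf cofreely generated by the constant family of sets `T`: a map from a presheaf `P`
to it is a family of functions from the sets `P c` to `T`. -/
def cofree (K : Type w) [SmallCategory K] (T : Type w) : Kᵒᵖ ⥤ Type w where
  obj c := ∀ d : K, (d ⟶ c.unop) → T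
  map f := ↾fun v d g => v d (g ≫ f.unop)
  map_id c := by
    ext v d g
    exact congrArg (v d) (Category.comp_id g)
  map_comp f f' := by
    ext v d g
    exact congrArg (v d) (Category.assoc g f'.unop f.unop).symm

/-- A subpresheaf of the product of the representable presheaf of `c` with `cofree K κ.out`
whose fibres over the representable have cardinality less than `κ`. Every family over the
representable of `c` whose fibres have cardinality less than `κ` is isomorphic to one of these, and
they form a set on which restriction is strictly functorial. -/
@[ext]
structure SmallFamily (κ : Cardinal.{w}) (c : K) : Type w where
  carrier : ∀ d : K, (d ⟶ c) → Set ((cofree K κ.out).obj (op d))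
  map_mem : ∀ {d e : K} (f : d ⟶ c) (g : e ⟶ d) (v : (cofree K κ.out).obj (op d)),
    v ∈ carrier d f → (cofree K κ.out).map g.op v ∈ carrier e (g ≫ f)
  card_lt : ∀ (d : K) (f : d ⟶ c), #(carrier d f) < κ

/-- The base of the universe of families with fibres of cardinality less than `κ`. -/
def smallFamilies (K : Type w) [SmallCategory K] (κ : Cardinal.{w}) : Kᵒᵖ ⥤ Type w where
  obj c := SmallFamily κ c.unop
  map h := ↾fun S =>
    { carrier d f := S.carrier d (f ≫ h.unop)
      map_mem f g v hv := by
        rw [Category.assoc]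
        exact S.map_mem _ g v hv
      card_lt d f := S.card_lt d _ }
  map_id c := by
    ext S : 3
    refine SmallFamily.ext (funext fun d => funext fun f => ?_)
    exact congrArg (S.carrier d) (Category.comp_id f)
  map_comp h h' := by
    ext S : 3
    refine SmallFamily.ext (funext fun d => funext fun f => ?_)
    exact congrArg (S.carrier d) (Category.assoc f h'.unop h.unop).symm

/-- The total space of the universe of families with fibres of cardinality less than `κ`. -/
def smallElements (K : Type w) [SmallCategory K] (κ : Cardinal.{w}) : Kᵒᵖ ⥤ Type w where
  obj c := {p : SmallFamily κ c.unop × (cofree K κ.out).obj c // p.2 ∈ p.1.carrier c.unop (𝟙 _)}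
  map {c d} h := ↾fun p => ⟨((smallFamilies K κ).map h p.1.1, (cofree K κ.out).map h p.1.2), by
    have := p.1.1.map_mem (𝟙 _) h.unop p.1.2 p.2
    rw [Category.comp_id] at this
    change _ ∈ p.1.1.carrier d.unop (𝟙 _ ≫ h.unop)
    rw [Category.id_comp]
    exact this⟩
  map_id c := by
    ext p : 3
    exact Subtype.ext (Prod.ext (Functor.map_id_apply (smallFamilies K κ) c p.1.1)
      (Functor.map_id_apply (cofree K κ.out) c p.1.2))
  map_comp h h' := by
    ext p : 3
    exact Subtype.ext (Prod.ext (Functor.map_comp_apply (smallFamilies K κ) h h' p.1.1)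
      (Functor.map_comp_apply (cofree K κ.out) h h' p.1.2))

/-- The universe of families with fibres of cardinality less than `κ`. -/
def smallUniverse (K : Type w) [SmallCategory K] (κ : Cardinal.{w}) :
    GenericFamily (Kᵒᵖ ⥤ Type w) where
  El := smallElements K κ
  U := smallFamilies K κ
  π := { app c := ↾fun p => p.1.1 }

/-- The underlying elements of the cofree presheaf. -/
def smallElementsVal (K : Type w) [SmallCategory K] (κ : Cardinal.{w}) :
    smallElements K κ ⟶ cofree K κ.out where
  app c := ↾fun p => p.1.2

/-- The fibre of a map of presheaves over an element. -/
abbrev Fibre {A X : Kᵒᵖ ⥤ Type w} (f : A ⟶ X) {c : Kᵒᵖ} (x : X.obj c) : Type w :=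
  {a : A.obj c // f.app c a = x}

variable {κ : Cardinal.{w}} {A P Q X Z : Kᵒᵖ ⥤ Type w}

theorem mk_fibre_lt_of_small {f : A ⟶ X} (h : (smallUniverse K κ).Small f) {c : Kᵒᵖ}
    (x : X.obj c) : #(Fibre f x) < κ := by
  obtain ⟨a, b, hab⟩ := h
  refine (mk_le_of_injective
    (β := SmallFamily.carrier (show SmallFamily κ c.unop from a.app c x) c.unop (𝟙 _))
    (f := fun y => ⟨(smallElementsVal K κ).app c (b.app c y.1), ?_⟩) ?_).trans_lt
      (SmallFamily.card_lt _ _ _)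
  · have h₁ : (b.app c y.1).1.1 = a.app c x :=
      (w_app_of_isPullback hab y.1).trans (congrArg (a.app c) y.2)
    rw [← h₁]
    exact (b.app c y.1).2
  · intro y z hyz
    refine Subtype.ext (ext_of_isPullback hab (Subtype.ext (Prod.ext ?_ ?_)) (y.2.trans z.2.symm))
    · exact (w_app_of_isPullback hab y.1).trans ((congrArg (a.app c) (y.2.trans z.2.symm)).trans
        (w_app_of_isPullback hab z.1).symm)
    · exact congrArg Subtype.val hyz

section Classify

variable (p : P ⟶ X) (v : P ⟶ cofree K κ.out) (hp : ∀ c (x : X.obj c), #(Fibre p x) < κ)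

/-- The map to the universe which names the image of a family `p` in the cofree presheaf. -/
def nameOf : X ⟶ (smallUniverse K κ).U where
  app c := ↾fun x =>
    { carrier d f := {t | ∃ q, p.app (op d) q = X.map f.op x ∧ v.app (op d) q = t}
      map_mem f g t := by
        rintro ⟨q, hq, rfl⟩
        refine ⟨P.map g.op q, ?_, NatTrans.naturality_apply v g.op q⟩
        rw [NatTrans.naturality_apply, hq, op_comp, Functor.map_comp_apply]
      card_lt d f := by
        refine lt_of_le_of_lt ?_ (hp _ (X.map f.op x))
        refine mk_le_of_surjective (f := fun q => ⟨v.app (op d) q.1, q.1, q.2, rfl⟩) ?_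
        rintro ⟨_, q, hq, rfl⟩
        exact ⟨⟨q, hq⟩, rfl⟩ }
  naturality c d h := by
    ext x : 3
    refine SmallFamily.ext (funext fun e => funext fun f => ?_)
    change {t | ∃ q, p.app (op e) q = X.map f.op (X.map h x) ∧ _} =
      {t | ∃ q, p.app (op e) q = X.map (f ≫ h.unop).op x ∧ _}
    rw [op_comp, Functor.map_comp_apply]
    rfl

/-- The map from a family to the total space of the universe which covers `nameOf`. -/
def elementOf : P ⟶ (smallUniverse K κ).El where
  app c := ↾fun q => ⟨((nameOf p v hp).app c (p.app c q), v.app c q),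
    q, (Functor.map_id_apply X c (p.app c q)).symm, rfl⟩
  naturality c d h := by
    ext q : 3
    have hv : v.app d (P.map h q) = (cofree K κ.out).map h (v.app c q) :=
      NatTrans.naturality_apply v h q
    refine Subtype.ext (Prod.ext ?_ hv)
    exact (congrArg ((nameOf p v hp).app d) (NatTrans.naturality_apply p h q)).trans
      (NatTrans.naturality_apply (nameOf p v hp) h (p.app c q))

theorem isPullback_elementOf (hv : ∀ c (q q' : P.obj c), p.app c q = p.app c q' →
    v.app c q = v.app c q' → q = q') :
    IsPullback (elementOf p v hp) p (smallUniverse K κ).π (nameOf p v hp) := by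
  refine isPullback_of_forall_elements rfl (fun c q q' h₁ h₂ => hv c q q' h₂ ?_) fun c s x h => ?_
  · exact congrArg (fun s => s.1.2) h₁
  · have hs : s.1.2 ∈ SmallFamily.carrier (show SmallFamily κ c.unop from
        (nameOf p v hp).app c x) c.unop (𝟙 _) := h ▸ s.2
    obtain ⟨q, hq, hq'⟩ := hs
    have hq'' : p.app c q = x := hq.trans (Functor.map_id_apply X c x)
    refine ⟨q, Subtype.ext (Prod.ext ?_ hq'), hq''⟩
    exact (congrArg ((nameOf p v hp).app c) hq'').trans h.symm

end Classify

/-- The map to a cofree presheaf determined by a family of functions. -/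
def toCofree {T : Type w} (τ : ∀ c, P.obj c → T) : P ⟶ cofree K T where
  app c := ↾fun q d g => τ (op d) (P.map g.op q)
  naturality c d h := by
    ext q
    funext e g
    change τ (op e) (P.map g.op (P.map h q)) = τ (op e) (P.map (g ≫ h.unop).op q)
    rw [op_comp, Functor.map_comp_apply]
    rfl

open Classical in
/-- Small families over a subobject which are named by a map to the universe extend strictly: since
the presheaf containing all named families is cofree, it suffices to choose the codes of the
remaining elements injectively in each fibre. -/
theorem exists_extension {m : Z ⟶ X} [Mono m] {p : P ⟶ X} {q : Q ⟶ Z} {i : Q ⟶ P}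
    (hsq : IsPullback i q p m) (hp : ∀ c (x : X.obj c), #(Fibre p x) < κ)
    (a : Z ⟶ (smallUniverse K κ).U) (a' : Q ⟶ (smallUniverse K κ).El)
    (ha : IsPullback a' q (smallUniverse K κ).π a) :
    ∃ (b : X ⟶ (smallUniverse K κ).U) (b' : P ⟶ (smallUniverse K κ).El),
      IsPullback b' p (smallUniverse K κ).π b ∧ m ≫ b = a ∧ i ≫ b' = a' := by
  have hm (c) : Function.Injective (m.app c) := app_injective_of_mono m c
  have hi (c) : Function.Injective (i.app c) := fun y y' h =>
    ext_of_isPullback hsq h (hm c ((w_app_of_isPullback hsq y).symm.trans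
      ((congrArg (p.app c) h).trans (w_app_of_isPullback hsq y'))))
  have hcode (c) (x : X.obj c) : Nonempty (Fibre p x ↪ κ.out) := by
    rw [← Cardinal.le_def, mk_out]
    exact (hp c x).le
  let code (c) (x : X.obj c) : Fibre p x ↪ κ.out := (hcode c x).some
  let u : Q ⟶ cofree K κ.out := a' ≫ smallElementsVal K κ
  let τ (c) (y : P.obj c) : κ.out :=
    if h : ∃ z, i.app c z = y then u.app c h.choose c.unop (𝟙 _) else code c (p.app c y) ⟨y, rfl⟩
  have hτ (c) (z : Q.obj c) : τ c (i.app c z) = u.app c z c.unop (𝟙 _) := by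
    have h : ∃ z', i.app c z' = i.app c z := ⟨z, rfl⟩
    simp only [τ, dif_pos h, hi c h.choose_spec]
  let v : P ⟶ cofree K κ.out := toCofree τ
  have hiv : i ≫ v = u := by
    ext c z
    funext d g
    change τ (op d) (P.map g.op (i.app c z)) = u.app c z d g
    rw [← NatTrans.naturality_apply, hτ, NatTrans.naturality_apply]
    exact congrArg (u.app c z d) (Category.id_comp g)
  have hiv' (c) (z : Q.obj c) : v.app c (i.app c z) = (a'.app c z).1.2 :=
    congrArg (fun k => k.app c z) hiv
  have ha₁ (c) (z : Q.obj c) : (a'.app c z).1.1 = a.app c (q.app c z) := w_app_of_isPullback ha z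
  have hpb := isPullback_elementOf p v hp fun c y y' h₁ h₂ => by
    by_cases hx : ∃ z, m.app c z = p.app c y
    · obtain ⟨z, hz⟩ := hx
      obtain ⟨r, rfl, hr⟩ := exists_of_isPullback hsq y z hz.symm
      obtain ⟨r', rfl, hr'⟩ := exists_of_isPullback hsq y' z (h₁.symm.trans hz.symm)
      refine congrArg _ (ext_of_isPullback ha (Subtype.ext (Prod.ext ?_ ?_)) (hr.trans hr'.symm))
      · rw [ha₁, ha₁, hr, hr']
      · rw [← hiv', ← hiv', h₂]
    · have hy {y'} (h : p.app c y = p.app c y') : ¬ ∃ z, i.app c z = y' := by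
        rintro ⟨z, rfl⟩
        exact hx ⟨q.app c z, (w_app_of_isPullback hsq z).symm.trans h.symm⟩
      have h₃ : τ c y = τ c y' := by
        have := congrFun (congrFun h₂ c.unop) (𝟙 _)
        change τ c (P.map (𝟙 c) y) = τ c (P.map (𝟙 c) y') at this
        rwa [Functor.map_id_apply, Functor.map_id_apply] at this
      simp only [τ, dif_neg (hy rfl), dif_neg (hy h₁)] at h₃
      have h₄ : ∀ (x x' : X.obj c) (r : Fibre p x) (r' : Fibre p x'), x = x' →
          code c x r = code c x' r' → r.1 = r'.1 := by
        rintro x _ r r' rfl h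
        exact congrArg _ ((code c x).injective h)
      exact h₄ _ _ ⟨y, rfl⟩ ⟨y', rfl⟩ h₁ h₃
  have hma : m ≫ nameOf p v hp = a := by
    refine hom_ext_elements fun c z => SmallFamily.ext (funext fun d => funext fun f => Set.ext fun t => ?_)
    have hcar : SmallFamily.carrier (show SmallFamily κ c.unop from a.app c z) d f =
        SmallFamily.carrier (show SmallFamily κ d from a.app (op d) (Z.map f.op z)) d (𝟙 d) := by
      rw [NatTrans.naturality_apply]
      exact congrArg (SmallFamily.carrier (show SmallFamily κ c.unop from a.app c z) d)
        (Category.id_comp f).symm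
    change (∃ y, p.app (op d) y = X.map f.op (m.app c z) ∧ v.app (op d) y = t) ↔
      t ∈ SmallFamily.carrier (show SmallFamily κ c.unop from a.app c z) d f
    rw [hcar, ← NatTrans.naturality_apply]
    constructor
    · rintro ⟨y, hy, rfl⟩
      obtain ⟨r, rfl, hr⟩ := exists_of_isPullback hsq y _ hy
      rw [hiv', ← hr, ← ha₁]
      exact (a'.app (op d) r).2
    · intro ht
      obtain ⟨r, hr, hr'⟩ := exists_of_isPullback ha
        (⟨(a.app (op d) (Z.map f.op z), t), ht⟩ : (smallElements K κ).obj (op d))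
        (Z.map f.op z) rfl
      refine ⟨i.app _ r, (w_app_of_isPullback hsq r).trans (congrArg _ hr'), ?_⟩
      rw [hiv', hr]
  refine ⟨nameOf p v hp, elementOf p v hp, hpb, hma, ?_⟩
  refine hom_ext_elements fun c z => Subtype.ext (Prod.ext ?_ (hiv' c z))
  rw [ha₁, ← hma]
  exact congrArg ((nameOf p v hp).app c) (w_app_of_isPullback hsq z)

/-- A map is classified by the universe iff its fibres have cardinality less than `κ`. -/
theorem small_iff {f : A ⟶ X} :
    (smallUniverse K κ).Small f ↔ ∀ c (x : X.obj c), #(Fibre f x) < κ := by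
  refine ⟨fun h _ x => mk_fibre_lt_of_small h x, fun h => ?_⟩
  -- The empty subobject imposes no condition on the extension.
  let O : Kᵒᵖ ⥤ Type w := (Functor.const _).obj PEmpty
  let o (Y : Kᵒᵖ ⥤ Type w) : O ⟶ Y :=
    { app c := ↾fun z => z.elim, naturality c d g := by ext z; exact z.elim }
  have : Mono (o X) := ⟨fun {W} g g' _ => by ext c y; exact (g.app c y).elim⟩
  obtain ⟨b, b', hb, -⟩ := exists_extension (m := o X) (q := 𝟙 O) (i := o A)
    (isPullback_of_forall_elements (by ext c z; exact z.elim) (fun c z => z.elim)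
      (fun c _ z => z.elim)) h (o _) (o _)
    (isPullback_of_forall_elements (by ext c z; exact z.elim) (fun c z => z.elim)
      (fun c _ z => z.elim))
  exact ⟨b, b', hb⟩

end Universe

/-! ### Dependent products of presheaves -/

section DependentProducts

open Cardinal Opposite

variable {K : Type w} [SmallCategory K] {A B X : Kᵒᵖ ⥤ Type w}

/-- An element of the dependent product of `g : B ⟶ A` along `f : A ⟶ X` at `c`: an element of
`X` together with a natural family of elements of `B` over the elements of `A` which lie over its
restrictions. -/
structure PiElement (g : B ⟶ A) (f : A ⟶ X) (c : K) where
  base : X.obj (op c)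
  sec : ∀ (d : K) (h : d ⟶ c) (a : A.obj (op d)), f.app _ a = X.map h.op base → B.obj (op d)
  app_sec : ∀ (d : K) (h : d ⟶ c) (a : A.obj (op d)) (ha : f.app _ a = X.map h.op base),
    g.app _ (sec d h a ha) = a
  map_sec : ∀ (d e : K) (h : d ⟶ c) (k : e ⟶ d) (a : A.obj (op d))
    (ha : f.app _ a = X.map h.op base)
    (ha' : f.app _ (A.map k.op a) = X.map (k ≫ h).op base),
    B.map k.op (sec d h a ha) = sec e (k ≫ h) (A.map k.op a) ha'

variable {g : B ⟶ A} {f : A ⟶ X}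

theorem PiElement.ext {c : K} {s t : PiElement g f c} (hb : s.base = t.base)
    (hs : ∀ d h a ha ha', s.sec d h a ha = t.sec d h a ha') : s = t := by
  obtain ⟨b, s, h₁, h₂⟩ := s
  obtain ⟨b', t, h₁', h₂'⟩ := t
  obtain rfl : b = b' := hb
  obtain rfl : s = t := by
    funext d h a ha
    exact hs d h a ha ha
  rfl

theorem PiElement.sec_congr {c : K} (s : PiElement g f c) {d : K} {h h' : d ⟶ c}
    (e : h = h') (a : A.obj (op d)) (ha : f.app _ a = X.map h.op s.base)
    (ha' : f.app _ a = X.map h'.op s.base) : s.sec d h a ha = s.sec d h' a ha' := by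
  subst e
  rfl

/-- The restriction of an element of a dependent product. -/
def PiElement.restrict {c c' : K} (k : c' ⟶ c) (s : PiElement g f c) : PiElement g f c' where
  base := X.map k.op s.base
  sec d h a ha := s.sec d (h ≫ k) a (by rw [ha, op_comp, Functor.map_comp_apply])
  app_sec d h a ha := s.app_sec _ _ _ _
  map_sec d e h k' a ha ha' := by
    have ha'' : f.app _ (A.map k'.op a) = X.map (k' ≫ h ≫ k).op s.base := by
      rw [ha', ← Category.assoc, op_comp (f := k' ≫ h), Functor.map_comp_apply]
    exact (s.map_sec _ _ _ k' a _ ha'').trans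
      (s.sec_congr (Category.assoc k' h k).symm _ _ _)

/-- The dependent product of `g : B ⟶ A` along `f : A ⟶ X`. -/
def piPresheaf (g : B ⟶ A) (f : A ⟶ X) : Kᵒᵖ ⥤ Type w where
  obj c := PiElement g f c.unop
  map k := ↾fun s => s.restrict k.unop
  map_id c := by
    refine ConcreteCategory.hom_ext _ _ fun (s : PiElement g f c.unop) => ?_
    have hb : X.map (𝟙 c) s.base = s.base := Functor.map_id_apply X c s.base
    exact PiElement.ext hb
      fun d h a ha ha' => s.sec_congr (Category.comp_id h) _ _ _
  map_comp k k' := by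
    refine ConcreteCategory.hom_ext _ _ fun (s : PiElement g f _) => ?_
    have hb : X.map (k ≫ k') s.base = X.map k' (X.map k s.base) :=
      Functor.map_comp_apply X k k' s.base
    exact PiElement.ext hb
      fun d h a ha ha' => s.sec_congr (Category.assoc h k'.unop k.unop).symm _ _ _

/-- The projection from a dependent product. -/
def piBase (g : B ⟶ A) (f : A ⟶ X) : piPresheaf g f ⟶ X where
  app c := ↾fun s => s.base

/-- The value of an element of a dependent product at an element of the fibre of `f`. -/
def evalPi {c : Kᵒᵖ} (s : (piPresheaf g f).obj c) (a : A.obj c)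
    (h : f.app c a = (piBase g f).app c s) : B.obj c :=
  PiElement.sec (show PiElement g f c.unop from s) c.unop (𝟙 _) a
    (h.trans (Functor.map_id_apply X c _).symm)

theorem evalPi_congr {c : Kᵒᵖ} {s t : (piPresheaf g f).obj c} {a b : A.obj c} (hs : s = t)
    (ha : a = b) (h : f.app c a = (piBase g f).app c s) (h' : f.app c b = (piBase g f).app c t) :
    evalPi s a h = evalPi t b h' := by
  subst hs ha
  rfl

theorem app_evalPi {c : Kᵒᵖ} (s : (piPresheaf g f).obj c) (a : A.obj c)
    (h : f.app c a = (piBase g f).app c s) : g.app c (evalPi s a h) = a :=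
  PiElement.app_sec _ _ _ _ _

theorem sec_eq_evalPi {c : K} (s : PiElement g f c) {d : K} (h : d ⟶ c) (a : A.obj (op d))
    (ha : f.app _ a = X.map h.op s.base) :
    s.sec d h a ha =
      evalPi ((piPresheaf g f).map h.op (show (piPresheaf g f).obj (op c) from s)) a ha :=
  s.sec_congr (Category.id_comp h).symm _ _ _

theorem map_evalPi {c d : Kᵒᵖ} (k : c ⟶ d) (s : (piPresheaf g f).obj c) (a : A.obj c)
    (h : f.app c a = (piBase g f).app c s)
    (h' : f.app d (A.map k a) = (piBase g f).app d ((piPresheaf g f).map k s)) :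
    B.map k (evalPi s a h) = evalPi ((piPresheaf g f).map k s) (A.map k a) h' := by
  have h'' : f.app d (A.map k a) =
      X.map (k.unop ≫ 𝟙 c.unop).op (PiElement.base (show PiElement g f c.unop from s)) := by
    rw [Category.comp_id]
    exact h'
  refine (PiElement.map_sec (show PiElement g f c.unop from s) c.unop d.unop (𝟙 _) k.unop a _
    h'').trans ?_
  exact PiElement.sec_congr (show PiElement g f c.unop from s)
    ((Category.comp_id _).trans (Category.id_comp _).symm) _ _ _

theorem mk_fibre_piBase_lt {κ : Cardinal.{w}} (hκ : κ.IsInaccessible)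
    (hK : ∀ c : K, #(Σ d, d ⟶ c) < κ)
    (hf : ∀ c (x : X.obj c), #(Fibre f x) < κ) (hg : ∀ c (a : A.obj c), #(Fibre g a) < κ)
    (c : Kᵒᵖ) (x : X.obj c) : #(Fibre (piBase g f) x) < κ := by
  refine (mk_le_of_injective
    (β := ∀ p : Σ h : Σ d, d ⟶ c.unop, Fibre f (X.map h.2.op x), Fibre g p.2.1)
    (f := fun s p => ⟨PiElement.sec (show PiElement g f c.unop from s.1) p.1.1 p.1.2 p.2.1
      (p.2.2.trans (congrArg (X.map p.1.2.op) s.2.symm)), PiElement.app_sec _ _ _ _ _⟩)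
    fun s t h => ?_).trans_lt ?_
  · refine Subtype.ext (PiElement.ext (s.2.trans t.2.symm) fun d k a ha ha' => ?_)
    exact congrArg Subtype.val (congrFun h ⟨⟨d, k⟩, a, ha.trans (congrArg (X.map k.op) s.2)⟩)
  · exact mk_pi_lt hκ (mk_sigma_lt hκ.isRegular (hK _) fun _ => hf _ _) fun _ => hg _ _

/-- The element of a pullback given by a compatible pair. -/
noncomputable def pullbackMk {Y : Over X} {c : Kᵒᵖ} (y : Y.left.obj c) (a : A.obj c)
    (h : Y.hom.app c y = f.app c a) : ((Over.pullback f).obj Y).left.obj c :=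
  (exists_of_isPullback (IsPullback.of_hasPullback Y.hom f) y a h).choose

theorem fst_pullbackMk {Y : Over X} {c : Kᵒᵖ} (y : Y.left.obj c) (a : A.obj c)
    (h : Y.hom.app c y = f.app c a) : (pullback.fst Y.hom f).app c (pullbackMk y a h) = y :=
  (exists_of_isPullback (IsPullback.of_hasPullback Y.hom f) y a h).choose_spec.1

theorem snd_pullbackMk {Y : Over X} {c : Kᵒᵖ} (y : Y.left.obj c) (a : A.obj c)
    (h : Y.hom.app c y = f.app c a) : (pullback.snd Y.hom f).app c (pullbackMk y a h) = a :=
  (exists_of_isPullback (IsPullback.of_hasPullback Y.hom f) y a h).choose_spec.2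

theorem pullbackMk_eq {Y : Over X} {c : Kᵒᵖ} (y : Y.left.obj c) (a : A.obj c)
    (h : Y.hom.app c y = f.app c a) (z : ((Over.pullback f).obj Y).left.obj c)
    (hy : (pullback.fst Y.hom f).app c z = y) (ha : (pullback.snd Y.hom f).app c z = a) :
    pullbackMk y a h = z :=
  ext_of_isPullback (IsPullback.of_hasPullback Y.hom f)
    ((fst_pullbackMk y a h).trans hy.symm) ((snd_pullbackMk y a h).trans ha.symm)

theorem over_w_app {Y Z : Over X} (φ : Y ⟶ Z) {c : Kᵒᵖ} (y : Y.left.obj c) :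
    Z.hom.app c (φ.left.app c y) = Y.hom.app c y :=
  congrArg (fun k => k.app c y) (Over.w φ)

theorem pullback_condition_app {Y : Over X} {c : Kᵒᵖ}
    (z : ((Over.pullback f).obj Y).left.obj c) :
    Y.hom.app c ((pullback.fst Y.hom f).app c z) = f.app c ((pullback.snd Y.hom f).app c z) :=
  w_app_of_isPullback (IsPullback.of_hasPullback Y.hom f) z

/-- Evaluation of a map into the dependent product on the pullback of its source. -/
noncomputable def piUncurry {Y : Over X} (φ : Y ⟶ Over.mk (piBase g f)) :
    (Over.pullback f).obj Y ⟶ Over.mk g :=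
  Over.homMk
    { app c := ↾fun z =>
        evalPi (φ.left.app c ((pullback.fst Y.hom f).app c z)) ((pullback.snd Y.hom f).app c z)
          ((pullback_condition_app z).symm.trans (over_w_app φ _).symm)
      naturality c d k := by
        refine ConcreteCategory.hom_ext _ _ fun z => ?_
        have h₁ : φ.left.app d ((pullback.fst Y.hom f).app d
            (((Over.pullback f).obj Y).left.map k z)) =
              (piPresheaf g f).map k (φ.left.app c ((pullback.fst Y.hom f).app c z)) :=
          (congrArg (φ.left.app d) (NatTrans.naturality_apply (pullback.fst Y.hom f) k z)).trans
            (NatTrans.naturality_apply φ.left k _)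
        have h₂ := NatTrans.naturality_apply (pullback.snd Y.hom f) k z
        have h (c) (z : ((Over.pullback f).obj Y).left.obj c) :
            f.app c ((pullback.snd Y.hom f).app c z) =
              (piBase g f).app c (φ.left.app c ((pullback.fst Y.hom f).app c z)) :=
          (pullback_condition_app z).symm.trans (over_w_app φ _).symm
        have h' := h d (((Over.pullback f).obj Y).left.map k z)
        have h'' := ((congrArg (f.app d) h₂).symm.trans h').trans (congrArg _ h₁)
        exact (evalPi_congr h₁ h₂ h' h'').trans (map_evalPi k _ _ (h c z) h'').symm }
    (hom_ext_elements fun c z => app_evalPi (φ.left.app c ((pullback.fst Y.hom f).app c z)) _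
      ((pullback_condition_app z).symm.trans (over_w_app φ _).symm))

/-- The map into the dependent product which corresponds to a map on the pullback of its
source. -/
noncomputable def piCurry {Y : Over X} (ψ : (Over.pullback f).obj Y ⟶ Over.mk g) :
    Y ⟶ Over.mk (piBase g f) :=
  Over.homMk
    { app c := ↾fun y => (show PiElement g f c.unop from
        { base := Y.hom.app c y
          sec d h a ha := ψ.left.app (op d) (pullbackMk (Y.left.map h.op y) a
            (by rw [ha, NatTrans.naturality_apply]))
          app_sec d h a ha := (over_w_app ψ _).trans (snd_pullbackMk _ _ _)
          map_sec d e h k a ha ha' := by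
            refine (NatTrans.naturality_apply ψ.left k.op _).symm.trans
              (congrArg (ψ.left.app (op e)) (pullbackMk_eq _ _ _ _ ?_ ?_).symm)
            · refine (NatTrans.naturality_apply (pullback.fst Y.hom f) k.op _).trans ?_
              rw [fst_pullbackMk, op_comp, Functor.map_comp_apply]
            · refine (NatTrans.naturality_apply (pullback.snd Y.hom f) k.op _).trans ?_
              rw [snd_pullbackMk] })
      naturality c d k := by
        refine ConcreteCategory.hom_ext _ _ fun y => ?_
        have hb : Y.hom.app d (Y.left.map k y) = X.map k (Y.hom.app c y) :=
          NatTrans.naturality_apply Y.hom k y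
        refine PiElement.ext hb fun e h a ha ha' => ?_
        refine congrArg (ψ.left.app (op e)) (pullbackMk_eq _ _ _ _ ?_ (snd_pullbackMk _ _ _))
        refine (fst_pullbackMk _ _ _).trans ?_
        exact Functor.map_comp_apply Y.left k h.op y }
    (hom_ext_elements fun c y => rfl)

theorem piUncurry_app {Y : Over X} (φ : Y ⟶ Over.mk (piBase g f)) {c : Kᵒᵖ}
    (z : ((Over.pullback f).obj Y).left.obj c) (y : Y.left.obj c) (a : A.obj c)
    (hy : (pullback.fst Y.hom f).app c z = y) (ha : (pullback.snd Y.hom f).app c z = a)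
    (h : f.app c a = (piBase g f).app c (φ.left.app c y)) :
    (piUncurry φ).left.app c z = evalPi (φ.left.app c y) a h := by
  subst hy ha
  rfl

theorem sec_piCurry {Y : Over X} (ψ : (Over.pullback f).obj Y ⟶ Over.mk g) {c : Kᵒᵖ}
    (y : Y.left.obj c) (d : K) (h : d ⟶ c.unop) (a : A.obj (op d))
    (ha : f.app _ a = X.map h.op (Y.hom.app c y))
    (z : ((Over.pullback f).obj Y).left.obj (op d))
    (hz : (pullback.fst Y.hom f).app _ z = Y.left.map h.op y)
    (hz' : (pullback.snd Y.hom f).app _ z = a) :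
    PiElement.sec (show PiElement g f c.unop from (piCurry ψ).left.app c y) d h a ha =
      ψ.left.app (op d) z :=
  congrArg (ψ.left.app (op d)) (pullbackMk_eq _ _ _ z hz hz')

/-- Maps into the dependent product over `X` are maps into `B` over `A` from the pullback. -/
noncomputable def piEquiv (Y : Over X) :
    (Y ⟶ Over.mk (piBase g f)) ≃ ((Over.pullback f).obj Y ⟶ Over.mk g) where
  toFun := piUncurry
  invFun := piCurry
  left_inv φ := by
    refine Over.OverMorphism.ext (hom_ext_elements fun c y => ?_)
    refine PiElement.ext (over_w_app φ y).symm fun d h a ha ha' => ?_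
    have hy : Y.hom.app (op d) (Y.left.map h.op y) = f.app (op d) a :=
      (NatTrans.naturality_apply Y.hom h.op y).trans ha.symm
    have ha'' : f.app (op d) a = (piBase g f).app (op d) (φ.left.app _ (Y.left.map h.op y)) :=
      hy.symm.trans (over_w_app φ _).symm
    refine (sec_piCurry (piUncurry φ) y d h a ha (pullbackMk _ _ hy) (fst_pullbackMk _ _ hy)
      (snd_pullbackMk _ _ hy)).trans ?_
    refine (piUncurry_app φ _ _ a (fst_pullbackMk _ _ hy) (snd_pullbackMk _ _ hy) ha'').trans ?_
    refine Eq.trans (evalPi_congr (NatTrans.naturality_apply φ.left h.op y) rfl ha'' ha') ?_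
    exact (sec_eq_evalPi (show PiElement g f c.unop from φ.left.app c y) h a ha').symm
  right_inv ψ := by
    refine Over.OverMorphism.ext (hom_ext_elements fun c z => ?_)
    have h := (pullback_condition_app z).symm
    refine (piUncurry_app (piCurry ψ) z _ _ rfl rfl h).trans ?_
    exact sec_piCurry ψ _ c.unop (𝟙 _) _ _ z (Functor.map_id_apply Y.left c _).symm rfl

theorem piEquiv_naturality {Y Y' : Over X} (φ : Y ⟶ Y') (φ' : Y' ⟶ Over.mk (piBase g f)) :
    piUncurry (φ ≫ φ') = (Over.pullback f).map φ ≫ piUncurry φ' := by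
  refine Over.OverMorphism.ext (hom_ext_elements fun c z => ?_)
  have h₁ : (pullback.fst Y'.hom f).app c (((Over.pullback f).map φ).left.app c z) =
      φ.left.app c ((pullback.fst Y.hom f).app c z) :=
    congrArg (fun (k : pullback Y.hom f ⟶ Y'.left) => k.app c z)
      (show ((Over.pullback f).map φ).left ≫ pullback.fst Y'.hom f =
        pullback.fst Y.hom f ≫ φ.left from pullback.lift_fst _ _ _)
  have h₂ : (pullback.snd Y'.hom f).app c (((Over.pullback f).map φ).left.app c z) =
      (pullback.snd Y.hom f).app c z :=
    congrArg (fun (k : pullback Y.hom f ⟶ A) => k.app c z)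
      (show ((Over.pullback f).map φ).left ≫ pullback.snd Y'.hom f =
        pullback.snd Y.hom f from pullback.lift_snd _ _ _)
  exact (piUncurry_app φ' _ _ _ h₁ h₂
    ((pullback_condition_app z).symm.trans (over_w_app (φ ≫ φ') _).symm)).symm

theorem nonempty_representableBy_pi (g : B ⟶ A) (f : A ⟶ X) :
    Nonempty (((Over.pullback f).op ⋙ yoneda.obj (Over.mk g)).RepresentableBy
      (Over.mk (piBase g f))) :=
  ⟨{ homEquiv := piEquiv _
     homEquiv_comp φ φ' := piEquiv_naturality φ φ' }⟩

end DependentProducts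

/-! ### The universe axioms -/

section UniverseAxioms

open Cardinal Opposite

variable {K : Type w} [SmallCategory K] {κ : Cardinal.{w}}

theorem small_toUnit_iff {X : Kᵒᵖ ⥤ Type w} :
    (smallUniverse K κ).Small (toUnit X) ↔ ∀ c, #(X.obj c) < κ := by
  rw [small_iff]
  refine forall_congr' fun c => ?_
  have e : ∀ x : (𝟙_ (Kᵒᵖ ⥤ Type w)).obj c, #(Fibre (toUnit X) x) = #(X.obj c) := fun x =>
    mk_congr (Equiv.subtypeUnivEquiv fun _ => rfl)
  exact ⟨fun h => e PUnit.unit ▸ h PUnit.unit, fun h x => (e x).trans_lt h⟩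

theorem mk_over_lt (hK : #(Arrow K) < κ) (c : K) : #(Σ d, d ⟶ c) < κ := by
  refine (mk_le_of_injective (f := fun p : Σ d, d ⟶ c => Arrow.mk p.2) ?_).trans_lt hK
  rintro ⟨d, f⟩ ⟨d', f'⟩ h
  obtain rfl : d = d' := congrArg Arrow.leftFunc.obj h
  obtain rfl : f = f' := Arrow.mk_injective _ _ h
  rfl

/-- The constant presheaf of natural numbers. -/
def natPresheaf (K : Type w) [SmallCategory K] : Kᵒᵖ ⥤ Type w :=
  (Functor.const _).obj (ULift ℕ)

/-- The zero of the presheaf of natural numbers. -/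
def natZero (K : Type w) [SmallCategory K] : 𝟙_ (Kᵒᵖ ⥤ Type w) ⟶ natPresheaf K :=
  NatTrans.mk (fun _ => ↾fun _ => (⟨0⟩ : ULift ℕ)) fun _ _ _ => rfl

/-- The successor map of the presheaf of natural numbers. -/
def natSucc (K : Type w) [SmallCategory K] : natPresheaf K ⟶ natPresheaf K :=
  NatTrans.mk (fun _ => ↾fun n : ULift ℕ => (⟨n.down + 1⟩ : ULift ℕ)) fun _ _ _ => rfl

theorem isNNO_natPresheaf : IsNNO (natZero K) (natSucc K) := by
  intro X x t
  refine ⟨{ app c := ↾fun n : ULift ℕ => (t.app c)^[n.down] (x.app c PUnit.unit)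
            naturality c d f := ?_ }, ⟨?_, ?_⟩, ?_⟩
  · refine ConcreteCategory.hom_ext _ _ fun n => ?_
    obtain ⟨n⟩ := n
    change (t.app d)^[n] (x.app d PUnit.unit) = X.map f ((t.app c)^[n] (x.app c PUnit.unit))
    induction n with
    | zero => exact NatTrans.naturality_apply x f PUnit.unit
    | succ n ih =>
      rw [Function.iterate_succ_apply', Function.iterate_succ_apply', ih]
      exact NatTrans.naturality_apply t f _
  · exact hom_ext_elements fun c _ => rfl
  · exact hom_ext_elements fun c n => Function.iterate_succ_apply' _ _ _
  · rintro h ⟨h₀, h₁⟩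
    refine hom_ext_elements fun c n => ?_
    obtain ⟨n⟩ := n
    change h.app c ⟨n⟩ = (t.app c)^[n] (x.app c PUnit.unit)
    induction n with
    | zero => exact congrArg (fun k => k.app c PUnit.unit) h₀
    | succ n ih =>
      rw [Function.iterate_succ_apply', ← ih]
      exact congrArg (fun k => k.app c (⟨n⟩ : ULift ℕ)) h₁

theorem mk_Ω_lt (hκ : κ.IsInaccessible) (hK : #(Arrow K) < κ) (c : Kᵒᵖ) :
    #((HasSubobjectClassifier.Ω (Kᵒᵖ ⥤ Type w)).obj c) < κ := by
  -- Any subobject classifier is isomorphic to the presheaf of sieves.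
  let e : HasSubobjectClassifier.Ω (Kᵒᵖ ⥤ Type w) ≅ Functor.sieves K :=
    HasSubobjectClassifier.exists_classifier.some.uniqueUpToIso (Presheaf.classifier K)
  let e' : (HasSubobjectClassifier.Ω (Kᵒᵖ ⥤ Type w)).obj c ≃ Sieve c.unop := (e.app c).toEquiv
  refine (mk_le_of_injective (β := Set (Σ d, d ⟶ c.unop))
    (f := fun s => {p | e' s p.2}) fun s t h => ?_).trans_lt ?_
  · refine e'.injective (Sieve.ext fun d f => ?_)
    exact iff_of_eq (congrArg (fun S : Set (Σ d, d ⟶ c.unop) => (⟨d, f⟩ : Σ d, d ⟶ c.unop) ∈ S) h)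
  · rw [mk_set]
    exact hκ.isStrongLimit.isStrongPrelimit (mk_over_lt hK _)

theorem isUniverse_smallUniverse (hκ : κ.IsInaccessible) (hK : #(Arrow K) < κ) :
    (smallUniverse K κ).IsUniverse where
  small_of_mono m _ := by
    refine small_iff.2 fun c x => ?_
    have : Subsingleton (Fibre m x) :=
      ⟨fun a b => Subtype.ext (app_injective_of_mono m c (a.2.trans b.2.symm))⟩
    exact (le_one_iff_subsingleton.2 this).trans_lt (one_lt_aleph0.trans hκ.aleph0_lt)
  small_comp g f hg hf := by
    refine small_iff.2 fun c x => ?_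
    refine (mk_le_of_injective (β := Σ a : Fibre f x, Fibre g a.1)
      (f := fun b => ⟨⟨g.app c b.1, b.2⟩, b.1, rfl⟩) fun b b' h => ?_).trans_lt
        (mk_sigma_lt hκ.isRegular (small_iff.1 hf c x) fun a => small_iff.1 hg c a.1)
    have h' := congrArg (fun p : Σ a : Fibre f x, Fibre g a.1 => p.2.1) h
    exact Subtype.ext h'
  small_pi g f hg hf := ⟨Over.mk (piBase g f),
    small_iff.2 (mk_fibre_piBase_lt hκ (mk_over_lt hK) (small_iff.1 hf) (small_iff.1 hg)),
    nonempty_representableBy_pi g f⟩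
  small_Ω := small_toUnit_iff.2 (mk_Ω_lt hκ hK)
  small_nat := ⟨natPresheaf K, _, _, isNNO_natPresheaf, small_toUnit_iff.2 fun _ =>
    (mk_le_aleph0 (α := ULift.{w} ℕ)).trans_lt hκ.aleph0_lt⟩

theorem mk_smallFamily_lt {κ' : Cardinal.{w}} (hκ' : κ'.IsInaccessible) (h : κ < κ')
    (hK : #(Arrow K) < κ') (c : K) : #(SmallFamily κ c) < κ' := by
  have hc (d : K) : #((cofree K κ.out).obj (op d)) < κ' := by
    refine (mk_le_of_injective (β := (Σ e, e ⟶ d) → κ.out)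
      (f := fun v p => v p.1 p.2) fun v v' h => ?_).trans_lt
        (mk_pi_lt hκ' (mk_over_lt hK d) fun _ => (mk_out κ).trans_lt h)
    funext e g
    exact congrFun h ⟨e, g⟩
  refine (mk_le_of_injective
    (β := ∀ p : Σ d, d ⟶ c, Set ((cofree K κ.out).obj (op p.1)))
    (f := fun S p => S.carrier p.1 p.2) fun S S' h => ?_).trans_lt
      (mk_pi_lt hκ' (mk_over_lt hK c) fun p => ?_)
  · refine SmallFamily.ext (funext fun d => funext fun f => ?_)
    exact congrFun h ⟨d, f⟩
  · rw [mk_set]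
    exact hκ'.isStrongLimit.isStrongPrelimit (hc _)

theorem isUniverseHierarchy_smallUniverse {J : Type*} [LinearOrder J] {κ : J → Cardinal.{w}}
    (hκ : StrictMono κ) (hκ_inaccessible : ∀ j, (κ j).IsInaccessible)
    (hK : ∀ j, #(Arrow K) < κ j) : IsUniverseHierarchy fun j => smallUniverse K (κ j) where
  isUniverse j := isUniverse_smallUniverse (hκ_inaccessible j) (hK j)
  small_U hij := small_toUnit_iff.2 fun _ =>
    mk_smallFamily_lt (hκ_inaccessible _) (hκ hij) (hK _) _
  small_le hij _ _ _ hf := small_iff.2 fun c x => (small_iff.1 hf c x).trans (hκ hij)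

end UniverseAxioms

section LOPSTopos

open Cardinal

variable {C : Type w} [SmallCategory C]

theorem strictness_smallUniverse (κ : Cardinal.{w}) :
    (presheafCubical C).Strictness (smallUniverse (C × Cube) κ) :=
  fun _ _ _ _ _ _ hsq hp a a' ha => exists_extension hsq (small_iff.1 hp) a a' ha

theorem mk_arrow_prod_cube_lt {κ : Cardinal.{w}} (hκ : ℵ₀ < κ) (hC : #(Arrow C) < κ) :
    #(Arrow (C × Cube)) < κ := by
  refine (mk_le_of_injective
    (β := Arrow C × ULift.{w} (Σ n m : ℕ, Fin n → FreeDM m))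
    (f := fun f => (Arrow.mk f.hom.1, ⟨f.right.2.dim, f.left.2.dim, f.hom.2⟩)) ?_).trans_lt ?_
  · rintro ⟨⟨a, ⟨m⟩⟩, ⟨b, ⟨n⟩⟩, ⟨f, g⟩⟩ ⟨⟨a', ⟨m'⟩⟩, ⟨b', ⟨n'⟩⟩, ⟨f', g'⟩⟩ h
    have h₁ := congrArg Prod.fst h
    have h₂ := congrArg (fun p => p.2.down) h
    cases h₁
    cases h₂
    rfl
  · rw [mk_prod, lift_id, lift_id]
    exact mul_lt_of_lt hκ.le hC (mk_le_aleph0.trans_lt hκ)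

/-- Presheaves on `C × Cube` form a LOPS topos. -/
theorem isLOPSTopos_presheafCubical {J : Type*} [LinearOrder J] {κ : J → Cardinal.{w}}
    (hκ : StrictMono κ) (hκ_inaccessible : ∀ j, (κ j).IsInaccessible)
    (hC : ∀ j, #(Arrow C) < κ j) : (presheafCubical C).IsLOPSTopos J where
  mono_faceEmb := mono_faceEmb_of_injective _ faceSub_injective
  face_bot := isBot_faceSub_bot
  face_inf := faceSub_inf
  face_sup := isLUB_faceSub_sup
  eqZero_spec := faceSub_eqZero
  connected φ ψ h _ := interval_connected φ ψ h
  zero_ne_one := isInitial_of_bot_eq_top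
  cof_eq_zero r := (isCof_iff _ _).2 ⟨_, faceSub_eqZero r⟩
  cof_eq_one := isCof_eq_one
  cof_or _ _ _ := isCof_sup
  cof_and _ _ := isCof_inf
  cof_forall _ _ := isCof_forall
  tiny := interval_tiny
  universes := ⟨fun j => smallUniverse (C × Cube) (κ j),
    isUniverseHierarchy_smallUniverse hκ hκ_inaccessible fun j =>
      mk_arrow_prod_cube_lt (hκ_inaccessible j).aleph0_lt (hC j),
    fun j => ⟨small_toUnit_iff.2 fun c =>
      (mk_le_aleph0 (α := ULift.{w} (FreeDM c.unop.2.dim))).trans_lt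
        (hκ_inaccessible j).aleph0_lt, strictness_smallUniverse _⟩⟩

end LOPSTopos

/-! ### Restriction along a functor as a morphism of LOPS topoi -/

section Morphisms

variable {C D : Type w} [SmallCategory C] [SmallCategory D] (F : C ⥤ D)

/-- Restriction of presheaves along `F × id`. -/
abbrev restriction : CubicalPSh D ⥤ CubicalPSh C :=
  (Functor.whiskeringLeft _ _ _).obj (timesCube F)

/-- The interval is constant in the first variable, hence preserved by restriction. -/
def restrictInterval : (restriction F).obj (presheafInterval D).X ≅ (presheafInterval C).X :=
  NatIso.ofComponents (fun _ => Iso.refl _) fun _ => rfl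

/-- The face lattice is constant in the first variable, hence preserved by restriction. -/
def restrictFace : (restriction F).obj (presheafFace D).X ≅ (presheafFace C).X :=
  NatIso.ofComponents (fun _ => Iso.refl _) fun _ => rfl

/-- The morphism of LOPS topoi given by restriction and right Kan extension. -/
def ranMorphism : LOPSMorphism (presheafCubical D) (presheafCubical C)
    ((timesCube F).ranAdjunction (Type w)) where
  lex := inferInstanceAs (PreservesFiniteLimits (restriction F))
  α := restrictInterval F
  β := restrictFace F
  α_deMorgan :=
    { bot := hom_ext_elements fun _ _ => rfl
      top := hom_ext_elements fun _ _ => rfl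
      inf := hom_ext_elements fun _ _ => rfl
      sup := hom_ext_elements fun _ _ => rfl
      neg := hom_ext_elements fun _ _ => rfl }
  β_lattice :=
    { bot := hom_ext_elements fun _ _ => rfl
      top := hom_ext_elements fun _ _ => rfl
      inf := hom_ext_elements fun _ _ => rfl
      sup := hom_ext_elements fun _ _ => rfl }
  compat := hom_ext_elements fun _ _ => rfl

/-! ### Left Kan extension of presheaves constant in the first variable -/

/-- The presheaf on `D × Cube` which is the restriction of a presheaf on cubes. -/
abbrev constantIn (D : Type w) [SmallCategory D] (Z : Cubeᵒᵖ ⥤ Type w) : CubicalPSh D :=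
  (CategoryTheory.Prod.snd D Cube).op ⋙ Z

/-- Maps of cubes as maps of `D × Cube`. -/
abbrev fixFst (d : D) {n n' : Cubeᵒᵖ} (f : n ⟶ n') :
    (Opposite.op (d, n.unop) : (D × Cube)ᵒᵖ) ⟶ Opposite.op (d, n'.unop) :=
  Quiver.Hom.op (X := (d, n'.unop)) (Y := (d, n.unop)) (𝟙 d, f.unop)

/-- Maps of `D` as maps of `D × Cube`. -/
abbrev fixSnd {d d' : D} (f : d' ⟶ d) (n : Cubeᵒᵖ) :
    (Opposite.op (d, n.unop) : (D × Cube)ᵒᵖ) ⟶ Opposite.op (d', n.unop) :=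
  Quiver.Hom.op (X := (d', n.unop)) (Y := (d, n.unop)) (f, 𝟙 n.unop)

theorem fixSnd_comp_fixFst {d d' : D} (f : d' ⟶ d) {n n' : Cubeᵒᵖ} (g : n ⟶ n') :
    fixSnd f n ≫ fixFst d' g = fixFst d g ≫ fixSnd f n' :=
  Quiver.Hom.unop_inj (Prod.ext ((Category.id_comp f).trans (Category.comp_id f).symm)
    ((Category.comp_id g.unop).trans (Category.id_comp g.unop).symm))

theorem fixFst_comp_fixSnd {d d' : D} (f : d' ⟶ d) {n n' : Cubeᵒᵖ} (g : n ⟶ n') :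
    fixFst d g ≫ fixSnd f n' =
      Quiver.Hom.op (X := (d', n'.unop)) (Y := (d, n.unop)) (f, g.unop) :=
  Quiver.Hom.unop_inj (Prod.ext (Category.comp_id f) (Category.id_comp g.unop))

/-- The slice of a presheaf on `D × Cube` at an object of `D`. -/
def slice (Y : CubicalPSh D) (d : D) : Cubeᵒᵖ ⥤ Type w where
  obj n := Y.obj (Opposite.op (d, n.unop))
  map f := Y.map (fixFst d f)
  map_id n := Y.map_id _
  map_comp f g := by
    rw [← Y.map_comp]
    congr 1
    exact Quiver.Hom.unop_inj (Prod.ext (Category.comp_id _).symm rfl)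

/-- The map of slices induced by a map of `D`. -/
def sliceMap (Y : CubicalPSh D) {d d' : D} (f : d' ⟶ d) : slice Y d ⟶ slice Y d' where
  app n := Y.map (fixSnd f n)
  naturality n n' g := by
    refine (Y.map_comp _ _).symm.trans (Eq.trans ?_ (Y.map_comp _ _))
    rw [fixSnd_comp_fixFst]

/-- The presheaf on `D × Cube`, constant in the second variable, whose value at `(d, n)` is the set
of maps from `Z` to the slice of `Y` at `d`. Its global elements are the maps from
`constantIn D Z` to `Y`. -/
def sliceHom (Z : Cubeᵒᵖ ⥤ Type w) (Y : CubicalPSh D) : CubicalPSh D where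
  obj c := Z ⟶ slice Y c.unop.1
  map f := ↾fun t => t ≫ sliceMap Y f.unop.1
  map_id c := by
    refine ConcreteCategory.hom_ext _ _ fun t => hom_ext_elements fun n z => ?_
    exact Functor.map_id_apply Y (Opposite.op (c.unop.1, n.unop)) _
  map_comp f g := by
    refine ConcreteCategory.hom_ext _ _ fun t => hom_ext_elements fun n z => ?_
    refine Eq.trans ?_ (Functor.map_comp_apply Y (fixSnd f.unop.1 n) (fixSnd g.unop.1 n) _)
    refine congrArg (fun k => Y.map k _) (Quiver.Hom.unop_inj (Prod.ext rfl ?_))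
    exact (Category.comp_id (𝟙 n.unop)).symm

/-- A map out of a presheaf constant in the first variable as a global element of `sliceHom`. -/
def toSliceHom {Z : Cubeᵒᵖ ⥤ Type w} {Y : CubicalPSh D} (t : constantIn D Z ⟶ Y) :
    𝟙_ (CubicalPSh D) ⟶ sliceHom Z Y where
  app c := ↾fun _ =>
    ({ app n := t.app (Opposite.op (c.unop.1, n.unop))
       naturality n n' g := t.naturality (fixFst c.unop.1 g) } : Z ⟶ slice Y c.unop.1)
  naturality c c' f := by
    refine ConcreteCategory.hom_ext _ _ fun _ => hom_ext_elements fun n z => ?_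
    refine Eq.trans ?_ (NatTrans.naturality_apply t (fixSnd f.unop.1 n) z)
    exact congrArg (t.app _) (Functor.map_id_apply Z n z).symm

/-- A family of elements over the restriction of the terminal presheaf, obtained from a map out of
a presheaf constant in the first variable. -/
def toRestrictSliceHom {Z : Cubeᵒᵖ ⥤ Type w} {Y : CubicalPSh D}
    (s : constantIn C Z ⟶ (restriction F).obj Y) :
    (restriction F).obj (𝟙_ (CubicalPSh D)) ⟶ (restriction F).obj (sliceHom Z Y) where
  app c := ↾fun _ =>
    ({ app n := s.app (Opposite.op (c.unop.1, n.unop))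
       naturality n n' g := (s.naturality (fixFst c.unop.1 g)).trans
        (congrArg (fun k => s.app _ ≫ Y.map k)
          (Quiver.Hom.unop_inj (Prod.ext (F.map_id _) rfl))) } : Z ⟶ slice Y (F.obj c.unop.1))
  naturality c c' f := by
    refine ConcreteCategory.hom_ext _ _ fun _ => hom_ext_elements fun n z => ?_
    refine Eq.trans ?_ (NatTrans.naturality_apply s (fixSnd f.unop.1 n) z)
    exact congrArg (s.app _) (Functor.map_id_apply Z n z).symm

/-- The map out of a presheaf constant in the first variable given by a global element of
`sliceHom`. -/
def ofSliceHom {Z : Cubeᵒᵖ ⥤ Type w} {Y : CubicalPSh D}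
    (g : 𝟙_ (CubicalPSh D) ⟶ sliceHom Z Y) : constantIn D Z ⟶ Y where
  app c := NatTrans.app (show Z ⟶ slice Y c.unop.1 from g.app c PUnit.unit)
    (Opposite.op c.unop.2)
  naturality c c' f := by
    let t : Z ⟶ slice Y c.unop.1 := g.app c PUnit.unit
    have h : (show Z ⟶ slice Y c'.unop.1 from g.app c' PUnit.unit) = t ≫ sliceMap Y f.unop.1 :=
      NatTrans.naturality_apply g f PUnit.unit
    refine ConcreteCategory.hom_ext _ _ fun z => ?_
    refine (congrArg (fun t' : Z ⟶ slice Y c'.unop.1 =>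
      t'.app (Opposite.op c'.unop.2) (Z.map f.unop.2.op z)) h).trans ?_
    refine (congrArg (Y.map (fixSnd f.unop.1 (Opposite.op c'.unop.2)))
      (NatTrans.naturality_apply t f.unop.2.op z)).trans ?_
    refine (Functor.map_comp_apply Y (fixFst c.unop.1 f.unop.2.op)
      (fixSnd f.unop.1 (Opposite.op c'.unop.2)) _).symm.trans ?_
    rw [fixFst_comp_fixSnd]
    rfl

/-- If restriction along `F × id` is bijective on global elements, then it is bijective on maps
out of presheaves constant in the first variable. -/
theorem bijective_restriction_map
    (H : ∀ W : CubicalPSh D, Function.Bijective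
      fun g : 𝟙_ (CubicalPSh D) ⟶ W => (restriction F).map g)
    (Z : Cubeᵒᵖ ⥤ Type w) (Y : CubicalPSh D) :
    Function.Bijective fun t : constantIn D Z ⟶ Y => (restriction F).map t := by
  constructor
  · intro t t' h
    have h' : toSliceHom t = toSliceHom t' := (H _).1 (by
      refine hom_ext_elements fun c _ => ?_
      refine NatTrans.ext (funext fun n => ?_)
      exact congrArg (fun k => NatTrans.app k (Opposite.op (c.unop.1, n.unop))) h)
    refine hom_ext_elements fun c z => ?_
    exact congrArg (fun k : 𝟙_ (CubicalPSh D) ⟶ sliceHom Z Y =>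
      NatTrans.app (show Z ⟶ slice Y c.unop.1 from k.app c PUnit.unit) (Opposite.op c.unop.2) z) h'
  · intro s
    obtain ⟨g, hg⟩ := (H (sliceHom Z Y)).2 (toRestrictSliceHom F s)
    refine ⟨ofSliceHom g, hom_ext_elements fun c z => ?_⟩
    exact congrArg (fun k : (restriction F).obj (𝟙_ (CubicalPSh D)) ⟶
      (restriction F).obj (sliceHom Z Y) =>
      NatTrans.app (show Z ⟶ slice Y (F.obj c.unop.1) from k.app c PUnit.unit)
        (Opposite.op c.unop.2) z) hg

/-- The counit of an adjunction is invertible at `A` iff the right adjoint is fully faithful on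
maps out of `A`. -/
theorem isIso_counit_app_iff {E E' : Type*} [Category* E] [Category* E'] {L : E ⥤ E'}
    {R : E' ⥤ E} (adj : L ⊣ R) (A : E') :
    IsIso (adj.counit.app A) ↔ ∀ Y, Function.Bijective fun g : A ⟶ Y => R.map g := by
  have h (Y : E') : (fun g : A ⟶ Y => R.map g) =
      adj.homEquiv (R.obj A) Y ∘ fun g => adj.counit.app A ≫ g := by
    funext g
    simp [Adjunction.homEquiv_unit]
  simp_rw [h, Equiv.comp_bijective]
  exact isIso_iff_coyoneda_map_bijective _

variable {F}

theorem isIso_counit_constantIn {L : CubicalPSh C ⥤ CubicalPSh D} (adj : L ⊣ restriction F)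
    (hL : PreservesFiniteLimits L) (Z : Cubeᵒᵖ ⥤ Type w) :
    IsIso (adj.counit.app (constantIn D Z)) := by
  refine (isIso_counit_app_iff adj _).2 fun Y => bijective_restriction_map F ?_ Z Y
  refine (isIso_counit_app_iff adj _).1 ?_
  have h₁ : IsTerminal (𝟙_ (CubicalPSh D)) := isTerminalTensorUnit
  have h₂ : IsTerminal (L.obj ((restriction F).obj (𝟙_ (CubicalPSh D)))) :=
    (h₁.isTerminalObj (restriction F)).isTerminalObj L
  exact isIso_of_isTerminal h₂ h₁ _

section Preservation

variable {L : CubicalPSh C ⥤ CubicalPSh D} (adj : L ⊣ restriction F)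

theorem app_unit_comp {P A : CubicalPSh C} {B : CubicalPSh D} {k : A ⟶ (restriction F).obj B}
    {α : L.obj A ⟶ B} (hα : adj.homEquiv _ _ α = k) (f : P ⟶ A) {c : (C × Cube)ᵒᵖ} (x : P.obj c) :
    (L.map f ≫ α).app ((timesCube F).obj c) ((adj.unit.app P).app c x) = k.app c (f.app c x) := by
  have h : adj.unit.app P ≫ (restriction F).map (L.map f ≫ α) = f ≫ k := by
    refine (adj.homEquiv_unit _ _ _).symm.trans ?_
    rw [Adjunction.homEquiv_naturality_left, hα]
  exact congrArg (fun k => k.app c x) h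

theorem homEquiv_app {A : CubicalPSh C} {B : CubicalPSh D} {k : A ⟶ (restriction F).obj B}
    {α : L.obj A ⟶ B} (hα : adj.homEquiv _ _ α = k) {c : (C × Cube)ᵒᵖ} (x : A.obj c) :
    α.app ((timesCube F).obj c) ((adj.unit.app A).app c x) = k.app c x :=
  congrArg (fun k => k.app c x) ((adj.homEquiv_unit _ _ _).symm.trans hα)

theorem hom_ext_unit {P : CubicalPSh C} {B : CubicalPSh D} {f g : L.obj P ⟶ B}
    (h : ∀ c (x : P.obj c), f.app ((timesCube F).obj c) ((adj.unit.app P).app c x) =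
      g.app ((timesCube F).obj c) ((adj.unit.app P).app c x)) : f = g := by
  refine (adj.homEquiv _ _).injective ?_
  rw [Adjunction.homEquiv_unit, Adjunction.homEquiv_unit]
  exact hom_ext_elements h

variable (hL : PreservesFiniteLimits L)

/-- The comparison of the intervals under a left exact left Kan extension. -/
noncomputable def lanInterval : L.obj (presheafInterval C).X ≅ (presheafInterval D).X :=
  L.mapIso (restrictInterval F).symm ≪≫
    @asIso _ _ _ _ _ (isIso_counit_constantIn adj hL cubeInterval)

/-- The comparison of the face lattices under a left exact left Kan extension. -/
noncomputable def lanFace : L.obj (presheafFace C).X ≅ (presheafFace D).X :=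
  L.mapIso (restrictFace F).symm ≪≫
    @asIso _ _ _ _ _ (isIso_counit_constantIn adj hL cubeFace)

theorem homEquiv_lanInterval :
    adj.homEquiv _ _ (lanInterval adj hL).hom = (restrictInterval F).inv :=
  (Equiv.eq_symm_apply _).1 (adj.homEquiv_counit _ _ _).symm

theorem homEquiv_lanFace :
    adj.homEquiv _ _ (lanFace adj hL).hom = (restrictFace F).inv :=
  (Equiv.eq_symm_apply _).1 (adj.homEquiv_counit _ _ _).symm

/-- The morphism of LOPS topoi given by a left exact left adjoint of restriction. -/
noncomputable def lanMorphism : LOPSMorphism (presheafCubical C) (presheafCubical D) adj where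
  lex := hL
  α := lanInterval adj hL
  β := lanFace adj hL
  α_deMorgan :=
    have h := homEquiv_lanInterval adj hL
    { bot := hom_ext_unit adj fun _ x => app_unit_comp adj h _ x
      top := hom_ext_unit adj fun _ x => app_unit_comp adj h _ x
      inf := hom_ext_unit adj fun c x => (app_unit_comp adj h _ x).trans
        (congrArg₂ (fun a b => (presheafInterval D).inf.app ((timesCube F).obj c) (a, b))
          (app_unit_comp adj h (fst _ _) x) (app_unit_comp adj h (snd _ _) x)).symm
      sup := hom_ext_unit adj fun c x => (app_unit_comp adj h _ x).trans
        (congrArg₂ (fun a b => (presheafInterval D).sup.app ((timesCube F).obj c) (a, b))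
          (app_unit_comp adj h (fst _ _) x) (app_unit_comp adj h (snd _ _) x)).symm
      neg := hom_ext_unit adj fun c x => (app_unit_comp adj h _ x).trans
        (congrArg ((presheafInterval D).neg.app ((timesCube F).obj c))
          (homEquiv_app adj h x)).symm }
  β_lattice :=
    have h := homEquiv_lanFace adj hL
    { bot := hom_ext_unit adj fun _ x => app_unit_comp adj h _ x
      top := hom_ext_unit adj fun _ x => app_unit_comp adj h _ x
      inf := hom_ext_unit adj fun c x => (app_unit_comp adj h _ x).trans
        (congrArg₂ (fun a b => (presheafFace D).inf.app ((timesCube F).obj c) (a, b))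
          (app_unit_comp adj h (fst _ _) x) (app_unit_comp adj h (snd _ _) x)).symm
      sup := hom_ext_unit adj fun c x => (app_unit_comp adj h _ x).trans
        (congrArg₂ (fun a b => (presheafFace D).sup.app ((timesCube F).obj c) (a, b))
          (app_unit_comp adj h (fst _ _) x) (app_unit_comp adj h (snd _ _) x)).symm }
  compat := hom_ext_unit adj fun c x => (app_unit_comp adj (homEquiv_lanFace adj hL) _ x).trans
    (congrArg ((presheafCubical D).eqZero.app ((timesCube F).obj c))
      (homEquiv_app adj (homEquiv_lanInterval adj hL) x)).symm

end Preservation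

end Morphisms

end LOPS

theorem proposition4p8 {C D : Type w} [SmallCategory C] [SmallCategory D] (F : C ⥤ D)
    {J : Type*} [LinearOrder J] (κ : J → Cardinal.{w}) (hκ : StrictMono κ)
    (hκ_inaccessible : ∀ j, (κ j).IsInaccessible)
    (hC : ∀ j, Cardinal.mk (Arrow C) < κ j) (hD : ∀ j, Cardinal.mk (Arrow D) < κ j) :
    (LOPS.presheafCubical C).IsLOPSTopos J ∧ (LOPS.presheafCubical D).IsLOPSTopos J ∧
    Nonempty (LOPS.LOPSMorphism (LOPS.presheafCubical D) (LOPS.presheafCubical C)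
      ((LOPS.timesCube F).ranAdjunction (Type w))) ∧
    (PreservesFiniteLimits ((LOPS.timesCube F).lan : LOPS.CubicalPSh C ⥤ LOPS.CubicalPSh D) →
      Nonempty (LOPS.LOPSMorphism (LOPS.presheafCubical C) (LOPS.presheafCubical D)
        ((LOPS.timesCube F).lanAdjunction (Type w)))) :=
  ⟨LOPS.isLOPSTopos_presheafCubical hκ hκ_inaccessible hC,
    LOPS.isLOPSTopos_presheafCubical hκ hκ_inaccessible hD,
    ⟨LOPS.ranMorphism F⟩, fun h => ⟨LOPS.lanMorphism _ h⟩⟩
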